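/- Let $K$ be a field of characteristic $0$ and let $F_3$ be the free metabelian associative algebra of rank $3$ over $K$, i.e. the unital associative algebra generated by $x_1,x_2,x_3$ that is free subject to the polynomial identity $[f,g][h,k]=0$. Let $F_3'$ be its commutator ideal, the two-sided ideal generated by all commutators $[f,g]=fg-gf$ (commutators are left normed). Let $U_3=\{u_1,u_2,u_3\}$ and $V_3=\{v_1,v_2,v_3\}$ be commuting variables; $F_3'$ is a $K[U_3,V_3]$-module via $f\cdot u_i=x_if$ and $f\cdot v_i=[f,x_i]$. Let $\delta=\delta(1,0)$ be the derivation of $F_3$ with $\delta(x_1)=0$, $\delta(x_2)=x_1$, $\delta(x_3)=0$, and let $\delta$ also denote the derivation of $K[U_3,V_3]$ with $\delta(u_1)=\delta(u_3)=\delta(v_1)=\delta(v_3)=0$, $\delta(u_2)=u_1$, $\delta(v_2)=v_1$. Write $K[U_3,V_3]^\delta$ for the kernel of $\delta$ in $K[U_3,V_3]$ and $(F_3')^\delta$ for the kernel of $\delta$ in $F_3'$, which is a $K[U_3,V_3]^\delta$-module. Then the $K[U_3,V_3]^\delta$-module $(F_3')^\delta$ is generated by \[ c_1=[x_2,x_1],\qquad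 c_2=[x_3,x_1],\qquad c_3=x_1[x_3,x_2]-x_2[x_3,x_1]. \] These three generators satisfy the relation \[ c_1\,u_1v_3-c_2\,(u_1v_2-u_2v_1)+c_3\,v_1=0, \] that is, \[ x_1[[x_2,x_1],x_3]-\bigl(x_1[[x_3,x_1],x_2]-x_2[[x_3,x_1],x_1]\bigr)+[x_1[x_3,x_2]-x_2[x_3,x_1],x_1]=0, \] and this is the only relation: if $p_1,p_2,p_3\in K[U_3,V_3]^\delta$ and $c_1p_1+c_2p_2+c_3p_3=0$, then there is $q\in K[U_3,V_3]^\delta$ with $(p_1,p_2,p_3)=q\cdot(u_1v_3,\,-(u_1v_2-u_2v_1),\,v_1)$. Moreover, give $x_1,x_2,x_3$ the bidegrees $(1,0),(0,1),(0,0)$, respectively, and let $W^{(a,b,n)}$ be the space of the elements of $W=(F_3')^\delta$ that are linear combinations of products of length $n$ and bidegree $(a,b)$ in $x_1,x_2,x_3$. All these spaces are finite dimensional, and \[ \sum_{a,b,n\ge 0}\dim_K W^{(a,b,n)}\,t_1^{a}t_2^{b}z^n=\frac{t_1z^2+t_1t_2z^2+t_1t_2z^3-t_1^2t_2z^4}{(1-z)^2(1-t_1z)^2(1-t_1t_2z^2)}.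 \] -/

import Mathlib

noncomputable section

namespace FreeMetabelian

/-- The relation on the free associative algebra `K⟨x₁,…,x_d⟩` that imposes the identity
`[f, g] [h, k] = 0` for all elements `f, g, h, k`. -/
inductive MetabelianRel (K : Type*) [Field K] (d : ℕ) :
    FreeAlgebra K (Fin d) → FreeAlgebra K (Fin d) → Prop
  | identity (f g h k : FreeAlgebra K (Fin d)) :
      MetabelianRel K d ((f * g - g * f) * (h * k - k * h)) 0

/-- The free metabelian (unital associative) algebra `F_d` of rank `d`: the relatively free algebra
of the variety defined by the polynomial identity `[x₁, x₂] [x₃, x₄] = 0`. -/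
def FAlg (K : Type*) [Field K] (d : ℕ) : Type _ := RingQuot (MetabelianRel K d)

section Algebra

variable (K : Type*) [Field K] (d : ℕ)

instance : Ring (FAlg K d) := inferInstanceAs (Ring (RingQuot (MetabelianRel K d)))

instance : Algebra K (FAlg K d) := inferInstanceAs (Algebra K (RingQuot (MetabelianRel K d)))

/-- The canonical projection `K⟨x₁,…,x_d⟩ → F_d`. -/
def mk : FreeAlgebra K (Fin d) →ₐ[K] FAlg K d := RingQuot.mkAlgHom K (MetabelianRel K d)

/-- The free generators of `F_d`; `x K d 0, x K d 1, …` are `x₁, x₂, …`. -/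
def x (i : Fin d) : FAlg K d :=
  mk K d (FreeAlgebra.ι K i)

/-- The commutator ideal `F_d'`, the two-sided ideal generated by all commutators
`⁅f, g⁆ = f * g - g * f`, as a `K`-subspace of `F_d`. -/
def commIdeal : Submodule K (FAlg K d) :=
  Submodule.span K {y | ∃ a f g b : FAlg K d, y = a * ⁅f, g⁆ * b}

variable {K d}

theorem mk_surjective : Function.Surjective (mk K d) := RingQuot.mkAlgHom_surjective K _

theorem bracket_mul_bracket (f g h k : FAlg K d) : ⁅f, g⁆ * ⁅h, k⁆ = 0 := by
  obtain ⟨f, rfl⟩ := mk_surjective f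
  obtain ⟨g, rfl⟩ := mk_surjective g
  obtain ⟨h, rfl⟩ := mk_surjective h
  obtain ⟨k, rfl⟩ := mk_surjective k
  have : mk K d ((f * g - g * f) * (h * k - k * h)) = mk K d 0 :=
    RingQuot.mkAlgHom_rel K (MetabelianRel.identity f g h k)
  simpa only [Ring.lie_def, map_mul, map_sub, map_zero] using this

theorem bracket_mul_mul_bracket (f g a h k : FAlg K d) : ⁅f, g⁆ * a * ⁅h, k⁆ = 0 := by
  have h1 : a * ⁅h, k⁆ = ⁅a * h, k⁆ - ⁅a, k⁆ * h := by
    simp only [Ring.lie_def]; noncomm_ring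
  rw [mul_assoc, h1, mul_sub, bracket_mul_bracket, ← mul_assoc, bracket_mul_bracket]
  simp

theorem mul_mem_commIdeal_left (a : FAlg K d) {f : FAlg K d} (hf : f ∈ commIdeal K d) :
    a * f ∈ commIdeal K d := by
  induction hf using Submodule.span_induction with
  | mem y hy =>
    obtain ⟨b, f, g, c, rfl⟩ := hy
    exact Submodule.subset_span ⟨a * b, f, g, c, by simp only [mul_assoc]⟩
  | zero => simp
  | add y z _ _ hy hz => rw [mul_add]; exact add_mem hy hz
  | smul r y _ hy => rw [mul_smul_comm]; exact Submodule.smul_mem _ _ hy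

theorem mul_mem_commIdeal_right (a : FAlg K d) {f : FAlg K d} (hf : f ∈ commIdeal K d) :
    f * a ∈ commIdeal K d := by
  induction hf using Submodule.span_induction with
  | mem y hy =>
    obtain ⟨b, f, g, c, rfl⟩ := hy
    exact Submodule.subset_span ⟨b, f, g, c * a, by simp only [mul_assoc]⟩
  | zero => simp
  | add y z _ _ hy hz => rw [add_mul]; exact add_mem hy hz
  | smul r y _ hy => rw [smul_mul_assoc]; exact Submodule.smul_mem _ _ hy

theorem bracket_mem_commIdeal (f g : FAlg K d) : ⁅f, g⁆ ∈ commIdeal K d :=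
  Submodule.subset_span ⟨1, f, g, 1, by simp⟩

/-- The subspace `commIdeal` is the two-sided ideal generated by the commutators. -/
theorem mem_commIdeal_iff (y : FAlg K d) :
    y ∈ commIdeal K d ↔ y ∈ TwoSidedIdeal.span {z : FAlg K d | ∃ f g : FAlg K d, z = ⁅f, g⁆} := by
  rw [TwoSidedIdeal.mem_span_iff_mem_addSubgroup_closure]
  constructor
  · intro hy
    have key : ∀ (c : FAlg K d) (z : FAlg K d), z ∈ commIdeal K d → c * z ∈ AddSubgroup.closure
        {z : FAlg K d | ∃ a ∈ (Set.univ : Set (FAlg K d)), ∃ b, ∃ w ∈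
          {z : FAlg K d | ∃ f g : FAlg K d, z = ⁅f, g⁆}, z = a * w * b} := by
      intro c z hz
      induction hz using Submodule.span_induction generalizing c with
      | mem z hz =>
        obtain ⟨a, f, g, b, rfl⟩ := hz
        exact AddSubgroup.subset_closure
          ⟨c * a, trivial, b, _, ⟨f, g, rfl⟩, by simp only [mul_assoc]⟩
      | zero => rw [mul_zero]; exact zero_mem _
      | add z w _ _ hz hw => rw [mul_add]; exact add_mem (hz c) (hw c)
      | smul r z _ hz =>
        have := hz (r • c)
        rwa [smul_mul_assoc, ← mul_smul_comm] at this
    have := key 1 y hy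
    rw [one_mul] at this
    refine AddSubgroup.closure_mono ?_ this
    rintro z ⟨a, -, b, w, hw, rfl⟩
    exact ⟨a * w, ⟨a, trivial, w, hw, rfl⟩, b, trivial, rfl⟩
  · intro hy
    induction hy using AddSubgroup.closure_induction with
    | mem z hz =>
      obtain ⟨_, ⟨a, -, w, ⟨f, g, rfl⟩, rfl⟩, b, -, rfl⟩ := hz
      exact Submodule.subset_span ⟨a, f, g, b, rfl⟩
    | zero => exact zero_mem _
    | add y z _ _ hy hz => exact add_mem hy hz
    | neg y _ hy => exact neg_mem hy

theorem mul_eq_zero_of_mem {f g : FAlg K d} (hf : f ∈ commIdeal K d) (hg : g ∈ commIdeal K d) :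
    f * g = 0 := by
  induction hf using Submodule.span_induction with
  | mem y hy =>
    obtain ⟨a, p, q, b, rfl⟩ := hy
    induction hg using Submodule.span_induction with
    | mem y hy =>
      obtain ⟨a', p', q', b', rfl⟩ := hy
      have : a * ⁅p, q⁆ * b * (a' * ⁅p', q'⁆ * b') = a * (⁅p, q⁆ * (b * a') * ⁅p', q'⁆) * b' := by
        simp only [mul_assoc]
      rw [this, bracket_mul_mul_bracket]; simp
    | zero => simp
    | add y z _ _ hy hz => rw [mul_add, hy, hz, add_zero]
    | smul r y _ hy => rw [mul_smul_comm, hy, smul_zero]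
  | zero => simp
  | add y z _ _ hy hz => rw [add_mul, hy, hz, add_zero]
  | smul r y _ hy => rw [smul_mul_assoc, hy, smul_zero]

end Algebra

section Action

variable {K : Type*} [Field K] {d : ℕ}

/-- The operators on `F_d'` by which the variables act: `u_i = Sum.inl i` acts as `f ↦ x_i f` and
`v_i = Sum.inr i` acts as `f ↦ f ad x_i = [f, x_i]`. -/
def op : Fin d ⊕ Fin d → Module.End K (commIdeal K d)
  | Sum.inl i => (LinearMap.mulLeft K (x K d i)).restrict fun _ hf => mul_mem_commIdeal_left _ hf
  | Sum.inr i => (LinearMap.mulRight K (x K d i) - LinearMap.mulLeft K (x K d i)).restrict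
      fun _ hf => sub_mem (mul_mem_commIdeal_right _ hf) (mul_mem_commIdeal_left _ hf)

theorem coe_op_inl (i : Fin d) (f : commIdeal K d) :
    (op (Sum.inl i) f : FAlg K d) = x K d i * f := rfl

theorem coe_op_inr (i : Fin d) (f : commIdeal K d) :
    (op (Sum.inr i) f : FAlg K d) = ⁅(f : FAlg K d), x K d i⁆ := rfl

theorem op_comm (s t : Fin d ⊕ Fin d) : (op s * op t : Module.End K (commIdeal K d)) = op t * op s := by
  have h1 : ∀ (f : commIdeal K d) (a b : FAlg K d), ⁅a, b⁆ * (f : FAlg K d) = 0 := fun f a b =>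
    mul_eq_zero_of_mem (bracket_mem_commIdeal a b) f.2
  have h2 : ∀ (f : commIdeal K d) (a b : FAlg K d), (f : FAlg K d) * ⁅a, b⁆ = 0 := fun f a b =>
    mul_eq_zero_of_mem f.2 (bracket_mem_commIdeal a b)
  ext f
  rw [Module.End.mul_apply, Module.End.mul_apply, ← sub_eq_zero]
  rcases s with i | i <;> rcases t with j | j <;>
    simp only [coe_op_inl, coe_op_inr]
  · rw [← h1 f (x K d i) (x K d j)]; simp only [Ring.lie_def]; noncomm_ring
  · rw [← h1 f (x K d j) (x K d i)]; simp only [Ring.lie_def]; noncomm_ring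
  · rw [← h1 f (x K d j) (x K d i)]; simp only [Ring.lie_def]; noncomm_ring
  · have h3 : (f : FAlg K d) * ⁅x K d j, x K d i⁆ - ⁅x K d j, x K d i⁆ * (f : FAlg K d) = 0 := by
      rw [h1, h2, sub_zero]
    rw [← h3]; simp only [Ring.lie_def]; noncomm_ring

variable (K d) in
/-- The polynomial algebra `K[U_d, V_d]`; the variables `Sum.inl i` are the `u`'s and the variables
`Sum.inr i` are the `v`'s. -/
abbrev UV : Type _ := MvPolynomial (Fin d ⊕ Fin d) K

open scoped IsMulCommutative in
variable (K d) in
/-- The representation of `K[U_d, V_d]` on `F_d'` that extends `op`. -/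
def act : UV K d →ₐ[K] Module.End K (commIdeal K d) :=
  haveI : IsMulCommutative (Algebra.adjoin K (Set.range (op (K := K) (d := d)))) :=
    Algebra.isMulCommutative_adjoin K (by
      rintro _ ⟨s, rfl⟩ _ ⟨t, rfl⟩
      exact op_comm s t)
  (Algebra.adjoin K (Set.range (op (K := K) (d := d)))).val.comp
    (MvPolynomial.aeval fun s =>
      (⟨op s, Algebra.subset_adjoin ⟨s, rfl⟩⟩ : Algebra.adjoin K (Set.range (op (K := K) (d := d)))))

theorem act_X (s : Fin d ⊕ Fin d) : act K d (MvPolynomial.X s) = op s := by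
  simp [act]

/-- `F_d'` as a `K[U_d, V_d]`-module. -/
instance : Module (UV K d) (commIdeal K d) :=
  Module.compHom _ (act K d).toRingHom

theorem smul_eq_act (p : UV K d) (f : commIdeal K d) : p • f = act K d p f := rfl

theorem coe_u_smul (i : Fin d) (f : commIdeal K d) :
    (((MvPolynomial.X (Sum.inl i) : UV K d) • f : commIdeal K d) : FAlg K d) = x K d i * f := by
  rw [smul_eq_act, act_X, coe_op_inl]

theorem coe_v_smul (i : Fin d) (f : commIdeal K d) :
    (((MvPolynomial.X (Sum.inr i) : UV K d) • f : commIdeal K d) : FAlg K d)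
      = ⁅(f : FAlg K d), x K d i⁆ := by
  rw [smul_eq_act, act_X, coe_op_inr]

theorem C_smul (r : K) (f : commIdeal K d) : (MvPolynomial.C r : UV K d) • f = r • f := by
  rw [smul_eq_act, ← MvPolynomial.algebraMap_eq, AlgHom.commutes, Module.algebraMap_end_apply]

instance : IsScalarTower K (UV K d) (commIdeal K d) :=
  ⟨fun r p f => by rw [MvPolynomial.smul_eq_C_mul, mul_smul, C_smul]⟩

end Action

section Derivation

variable {K : Type*} [Field K] {d : ℕ} (α : Matrix (Fin d) (Fin d) K)

/-- The derivation of `F_d` is built as an algebra homomorphism `f ↦ f + ε δ(f)` to the square-zero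
extension `F_d ⊕ ε F_d`. -/
def freeDual : FreeAlgebra K (Fin d) →ₐ[K] TrivSqZeroExt (FAlg K d) (FAlg K d) :=
  FreeAlgebra.lift K fun j => TrivSqZeroExt.inl (x K d j) + TrivSqZeroExt.inr (∑ i, α i j • x K d i)

theorem freeDual_rel ⦃f g : FreeAlgebra K (Fin d)⦄ (h : MetabelianRel K d f g) :
    freeDual α f = freeDual α g := by
  obtain ⟨f, g, h, k⟩ := h
  have e : ∀ a b c e : FAlg K d, (a * b - b * a) * (c * e - e * c) = 0 := bracket_mul_bracket
  rw [map_mul, map_sub, map_sub, map_mul, map_mul, map_mul, map_mul, map_zero]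
  generalize freeDual α f = f
  generalize freeDual α g = g
  generalize freeDual α h = h
  generalize freeDual α k = k
  ext
  · simpa using e _ _ _ _
  · simp only [TrivSqZeroExt.snd_mul, TrivSqZeroExt.fst_sub, TrivSqZeroExt.fst_mul,
      TrivSqZeroExt.snd_sub, smul_eq_mul, MulOpposite.smul_eq_mul_unop, MulOpposite.unop_op,
      TrivSqZeroExt.snd_zero]
    have h1 := e f.fst g.fst h.fst k.snd
    have h2 := e f.fst g.fst h.snd k.fst
    have h3 := e f.fst g.snd h.fst k.fst
    have h4 := e f.snd g.fst h.fst k.fst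
    calc _ = (f.fst * g.fst - g.fst * f.fst) * (h.fst * k.snd - k.snd * h.fst)
          + (f.fst * g.fst - g.fst * f.fst) * (h.snd * k.fst - k.fst * h.snd)
          + (f.fst * g.snd - g.snd * f.fst) * (h.fst * k.fst - k.fst * h.fst)
          + (f.snd * g.fst - g.fst * f.snd) * (h.fst * k.fst - k.fst * h.fst) := by
            noncomm_ring
      _ = 0 := by rw [h1, h2, h3, h4]; simp

/-- The homomorphism `f ↦ f + ε δ(f)` on `F_d`. -/
def dual : FAlg K d →ₐ[K] TrivSqZeroExt (FAlg K d) (FAlg K d) :=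
  RingQuot.liftAlgHom K ⟨freeDual α, freeDual_rel α⟩

/-- The linear derivation `δ` of `F_d` with matrix `α`, that is, `δ(x_j) = ∑ i, α_{ij} x_i`. -/
def der : FAlg K d →ₗ[K] FAlg K d :=
  ((TrivSqZeroExt.sndHom (FAlg K d) (FAlg K d)).restrictScalars K).comp (dual α).toLinearMap

theorem dual_x (j : Fin d) :
    dual α (x K d j) = TrivSqZeroExt.inl (x K d j) + TrivSqZeroExt.inr (∑ i, α i j • x K d i) := by
  have h : dual α (x K d j) = freeDual α (FreeAlgebra.ι K j) :=
    RingQuot.liftAlgHom_mkAlgHom_apply K (freeDual α) (freeDual_rel α) _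
  rw [h, freeDual, FreeAlgebra.lift_ι_apply]

theorem der_x (j : Fin d) : der α (x K d j) = ∑ i, α i j • x K d i := by
  change (dual α (x K d j)).snd = _
  rw [dual_x]; simp

theorem fst_dual (f : FAlg K d) : (dual α f).fst = f := by
  have : (TrivSqZeroExt.fstHom K (FAlg K d) (FAlg K d)).comp (dual α) = AlgHom.id K _ := by
    apply RingQuot.ringQuot_ext'
    ext j
    change (dual α (x K d j)).fst = x K d j
    rw [dual_x]; simp
  exact DFunLike.congr_fun this f

theorem der_mul (f g : FAlg K d) : der α (f * g) = der α f * g + f * der α g := by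
  change (dual α (f * g)).snd = (dual α f).snd * g + f * (dual α g).snd
  rw [map_mul, TrivSqZeroExt.snd_mul, fst_dual, fst_dual, add_comm]
  rfl

theorem der_bracket (f g : FAlg K d) : der α ⁅f, g⁆ = ⁅der α f, g⁆ + ⁅f, der α g⁆ := by
  simp only [Ring.lie_def, map_sub, der_mul]; abel

theorem der_mem {f : FAlg K d} (hf : f ∈ commIdeal K d) : der α f ∈ commIdeal K d := by
  induction hf using Submodule.span_induction with
  | mem y hy =>
    obtain ⟨a, f, g, b, rfl⟩ := hy
    have h := bracket_mem_commIdeal (K := K) (d := d)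
    rw [der_mul, der_mul, der_bracket]
    refine add_mem (mul_mem_commIdeal_right _ (add_mem (mul_mem_commIdeal_left _ (h _ _))
      (mul_mem_commIdeal_left _ (add_mem (h _ _) (h _ _))))) ?_
    exact mul_mem_commIdeal_right _ (mul_mem_commIdeal_left _ (h _ _))
  | zero => simp
  | add y z _ _ hy hz => rw [map_add]; exact add_mem hy hz
  | smul r y _ hy => rw [map_smul]; exact Submodule.smul_mem _ _ hy

/-- The derivation `δ` of `K[U_d, V_d]` with `δ(u_j) = ∑ i, α_{ij} u_i` and
`δ(v_j) = ∑ i, α_{ij} v_i`. -/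
def polyDer : Derivation K (UV K d) (UV K d) :=
  MvPolynomial.mkDerivation K (Sum.elim
    (fun j => ∑ i, α i j • MvPolynomial.X (Sum.inl i))
    (fun j => ∑ i, α i j • MvPolynomial.X (Sum.inr i)))

/-- The algebra of constants `K[U_d, V_d]^δ`. -/
def polyConst : Subalgebra K (UV K d) where
  carrier := {p | polyDer α p = 0}
  mul_mem' {p q} hp hq := by
    simp only [Set.mem_ofPred_eq] at *
    rw [Derivation.leibniz, hp, hq]; simp
  add_mem' {p q} hp hq := by
    simp only [Set.mem_ofPred_eq] at *
    rw [map_add, hp, hq, add_zero]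
  algebraMap_mem' r := Derivation.map_algebraMap _ r

theorem der_X_smul (s : Fin d ⊕ Fin d) (f : commIdeal K d) :
    der α ((MvPolynomial.X s : UV K d) • f : commIdeal K d) =
      (polyDer α (MvPolynomial.X s) • f : commIdeal K d) +
      ((MvPolynomial.X s : UV K d) • (⟨der α f, der_mem α f.2⟩ : commIdeal K d) :
        commIdeal K d) := by
  rcases s with j | j
  · rw [coe_u_smul, coe_u_smul, der_mul, der_x, polyDer, MvPolynomial.mkDerivation_X]
    simp only [Sum.elim_inl, Finset.sum_smul, Submodule.coe_sum, Finset.sum_mul, smul_assoc,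
      Submodule.coe_smul, coe_u_smul, smul_mul_assoc]
  · rw [coe_v_smul, coe_v_smul, der_bracket, der_x, polyDer, MvPolynomial.mkDerivation_X, add_comm]
    simp only [Sum.elim_inr, Finset.sum_smul, Submodule.coe_sum, smul_assoc,
      Submodule.coe_smul, coe_v_smul, Ring.lie_def, Finset.mul_sum,
      Finset.sum_mul, smul_sub, Finset.sum_sub_distrib, mul_smul_comm, smul_mul_assoc]

/-- The derivations of `F_d` and of `K[U_d, V_d]` are compatible with the module structure. -/
theorem der_smul (p : UV K d) (f : commIdeal K d) :
    der α (p • f : commIdeal K d) = (polyDer α p • f : commIdeal K d) +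
      (p • (⟨der α f, der_mem α f.2⟩ : commIdeal K d) : commIdeal K d) := by
  induction p using MvPolynomial.induction_on generalizing f with
  | C r =>
    rw [C_smul, C_smul, ← MvPolynomial.algebraMap_eq, Derivation.map_algebraMap]
    simp
  | add p q hp hq =>
    rw [add_smul, map_add, add_smul, add_smul]
    simp only [Submodule.coe_add, map_add, hp, hq]
    abel
  | mul_X p s hp =>
    have e : (⟨der α ((MvPolynomial.X s : UV K d) • f : commIdeal K d), der_mem α (Subtype.coe_prop _)⟩
        : commIdeal K d) = polyDer α (MvPolynomial.X s) • f +
          (MvPolynomial.X s : UV K d) • (⟨der α f, der_mem α f.2⟩ : commIdeal K d) :=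
      Subtype.ext (der_X_smul α s f)
    rw [mul_smul, hp, e, Derivation.leibniz, smul_add, add_smul, smul_eq_mul, smul_eq_mul,
      mul_comm (MvPolynomial.X s) (polyDer α p), mul_smul, mul_smul, mul_smul]
    simp only [Submodule.coe_add]
    abel

/-- The `K[U_d, V_d]^δ`-module `(F_d')^δ` of the constants of `δ` in the commutator ideal. -/
def constModule : Submodule (polyConst α) (commIdeal K d) where
  carrier := {f | der α f = 0}
  zero_mem' := by simp
  add_mem' {f g} hf hg := by
    simp only [Set.mem_ofPred_eq] at *
    rw [Submodule.coe_add, map_add, hf, hg, add_zero]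
  smul_mem' p f hf := by
    simp only [Set.mem_ofPred_eq] at *
    have hp : polyDer α (p : UV K d) = 0 := p.2
    have h0 : (⟨der α f, der_mem α f.2⟩ : commIdeal K d) = 0 := Subtype.ext hf
    change der α ((p : UV K d) • f : commIdeal K d) = 0
    rw [der_smul, hp, h0]
    simp

end Derivation

section Grading

variable (K : Type*) [Field K] {d : ℕ}

/-- If every generator `x_i` is given the weight `w i`, the component of weight `n` of `F_d`: the
span of all products `x_{i_1} ⋯ x_{i_k}` with `w i_1 + ⋯ + w i_k = n`. -/
def weightComp {σ : Type*} (w : Fin d → σ →₀ ℕ) (n : σ →₀ ℕ) : Submodule K (FAlg K d) :=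
  Submodule.span K {y | ∃ l : List (Fin d), (l.map w).sum = n ∧ y = (l.map (x K d)).prod}

variable {K} in
/-- The component of weight `n` of `(F_d')^δ`. -/
def constComp (α : Matrix (Fin d) (Fin d) K) {σ : Type*} (w : Fin d → σ →₀ ℕ) (n : σ →₀ ℕ) :
    Submodule K (FAlg K d) :=
  commIdeal K d ⊓ LinearMap.ker (der α) ⊓ weightComp K w n

variable {K} in
/-- The Hilbert series of `(F_d')^δ` with respect to the weights `w`, with integer coefficients. -/
def hilbertSeries (α : Matrix (Fin d) (Fin d) K) {σ : Type*} (w : Fin d → σ →₀ ℕ) :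
    MvPowerSeries σ ℤ :=
  fun n => (Module.finrank K (constComp α w n) : ℤ)

end Grading

section BlocksTwoOne

variable (K : Type*) [Field K]

/-- The matrix of `δ = δ(1,0)`: `δ(x₁) = 0`, `δ(x₂) = x₁`, `δ(x₃) = 0`. -/
def δ₁₀ : Matrix (Fin 3) (Fin 3) K := !![0, 1, 0; 0, 0, 0; 0, 0, 0]

/-- The variables `0, 1, 2` stand for `t₁, t₂, z`. The bidegrees of `x₁, x₂, x₃` for `δ(1,0)` are
`(1,0), (0,1), (0,0)`, and `z` counts the total degree. -/
def bidegree : Fin 3 → Fin 3 →₀ ℕ :=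
  ![Finsupp.single 0 1 + Finsupp.single 2 1, Finsupp.single 1 1 + Finsupp.single 2 1,
    Finsupp.single 2 1]

/-- The variables `u₁, u₂, u₃` of `K[U₃, V₃]`, indexed by `0, 1, 2`. -/
def u (i : Fin 3) : UV K 3 := MvPolynomial.X (Sum.inl i)

/-- The variables `v₁, v₂, v₃` of `K[U₃, V₃]`, indexed by `0, 1, 2`. -/
def v (i : Fin 3) : UV K 3 := MvPolynomial.X (Sum.inr i)

/-- `[x₂, x₁]` -/
def c₁ : commIdeal K 3 := ⟨⁅x K 3 1, x K 3 0⁆, bracket_mem_commIdeal _ _⟩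

/-- `[x₃, x₁]` -/
def c₂ : commIdeal K 3 := ⟨⁅x K 3 2, x K 3 0⁆, bracket_mem_commIdeal _ _⟩

/-- `x₁ [x₃, x₂] - x₂ [x₃, x₁]` -/
def c₃ : commIdeal K 3 :=
  ⟨x K 3 0 * ⁅x K 3 2, x K 3 1⁆ - x K 3 1 * ⁅x K 3 2, x K 3 0⁆,
    sub_mem (mul_mem_commIdeal_left _ (bracket_mem_commIdeal _ _))
      (mul_mem_commIdeal_left _ (bracket_mem_commIdeal _ _))⟩

end BlocksTwoOne

end FreeMetabelian

end

/-! Two ingredients carry the proof: a description of the constants in the polynomial ring, and an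
embedding of `F_3'` into two copies of that ring.

Polynomial side. Once `u₁` is inverted, `v₂` can be replaced by `u₁v₂ - u₂v₁`, and `δ` becomes `u₁
∂/∂u₂` over the ring generated by `v₁, u₁, u₁v₂ - u₂v₁, u₃, v₃`. In characteristic 0 its kernel
consists of the elements free of `u₂`. The denominators can be cleared because the generators other
than `u₁` stay algebraically independent modulo `u₁` (`exists_constHom_eq`). These five generators
are algebraically independent, so the ring of constants is a polynomial ring.

Module side. Sending `x_i` to an upper triangular matrix yields Fox derivatives, which are
`K[U,V]`-linear on `F_3'`. Those with respect to `x₂` and `x₃` are jointly injective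
(`eq_zero_of_fox_eq_zero`) and commute with `δ` (`fox_der`). So a constant of `F_3'` is a pair `(a,
b)` of polynomial constants for which `v₁` divides `a v₂ + b v₃`. Modulo `v₁` this says that `(a,
b)` is proportional to `(u₁v₃, -u₁v₂)`, which comes from `c₃` up to sign; the multiples of `v₁` come
from `c₁` and `c₂` (`exists_comb_of_der_eq_zero`). In the same coordinates a relation forces `v₁` to
divide the coefficient of `c₃`, which leaves only the multiples of the given one.

Hilbert series. Modulo the relation the coefficient of `c₃` can be made free of `v₁`, uniquely. This
gives a homogeneous basis indexed by monomials in 5, 5 and 4 variables (`range_combMap`,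
`ker_combMap`), and the series is obtained by counting exponents. -/

noncomputable section

namespace FreeMetabelian

/-! ### The algebra of constants of `δ(1,0)` in `K[U₃, V₃]`. -/

section PolynomialConstants

variable (K : Type*) [Field K]

/-- The constant `u₁ v₂ - u₂ v₁` of `δ(1,0)`. -/
def detUV : UV K 3 := u K 0 * v K 1 - u K 1 * v K 0

/-- The generators `v₁, u₁, u₁ v₂ - u₂ v₁, u₃, v₃` of the algebra of constants of `δ(1,0)`. -/
def constGen : Fin 5 → UV K 3 := ![v K 0, u K 0, detUV K, u K 2, v K 2]

/-- The parametrization of the algebra of constants of `δ(1,0)` by a polynomial algebra. -/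
def constHom : MvPolynomial (Fin 5) K →ₐ[K] UV K 3 := MvPolynomial.aeval (constGen K)

/-- The extension of `constHom` that sends the additional variable to `u₂`. -/
def extHom : Polynomial (MvPolynomial (Fin 5) K) →+* UV K 3 :=
  Polynomial.eval₂RingHom (constHom K).toRingHom (u K 1)

theorem constHom_X (i : Fin 5) : constHom K (MvPolynomial.X i) = constGen K i :=
  MvPolynomial.aeval_X _ _

theorem extHom_C (p : MvPolynomial (Fin 5) K) : extHom K (Polynomial.C p) = constHom K p := by
  simp [extHom]

theorem extHom_X : extHom K Polynomial.X = u K 1 := by simp [extHom]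

/-- The fraction field, kept abstract: the substitutions below need only some field in which to
divide. -/
theorem exists_injective_algHom_field.{w} (A : Type w) [CommRing A] [IsDomain A] [Algebra K A] :
    ∃ (F : Type w) (_ : Field F) (_ : Algebra K F) (a : A →ₐ[K] F), Function.Injective a :=
  ⟨FractionRing A, inferInstance, inferInstance, IsScalarTower.toAlgHom K A _,
    IsFractionRing.injective A _⟩

/-- There is a left inverse with values in the fraction field: the equation `det = u₁v₂ - u₂v₁` can
be solved for `v₂` by dividing by `u₁`. -/
theorem extHom_injective : Function.Injective (extHom K) := by
  let F := FractionRing (Polynomial (MvPolynomial (Fin 5) K))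
  let a : Polynomial (MvPolynomial (Fin 5) K) →+* F := algebraMap _ _
  let g : Fin 5 → F := fun i => a (Polynomial.C (MvPolynomial.X i))
  let T : F := a Polynomial.X
  have ha : Function.Injective a := IsFractionRing.injective _ _
  have g1 : g 1 ≠ 0 := by
    intro h
    rw [← map_zero a] at h
    exact MvPolynomial.X_ne_zero (R := K) (1 : Fin 5) (Polynomial.C_injective (by simpa using ha h))
  let s : UV K 3 →+* F := MvPolynomial.eval₂Hom (a.comp (Polynomial.C.comp MvPolynomial.C))
    (Sum.elim ![g 1, T, g 3] ![g 0, (g 2 + T * g 0) / g 1, g 4])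
  have hs : s.comp (extHom K) = a := by
    apply Polynomial.ringHom_ext'
    · apply MvPolynomial.ringHom_ext
      · intro r
        change s (extHom K (Polynomial.C (MvPolynomial.C r))) = _
        rw [extHom_C, ← MvPolynomial.algebraMap_eq, AlgHom.commutes, MvPolynomial.algebraMap_eq]
        simp [s]
      · intro i
        change s (extHom K (Polynomial.C (MvPolynomial.X i))) = g i
        rw [extHom_C, constHom_X]
        fin_cases i <;> simp [constGen, detUV, u, v, s]
        rw [mul_div_cancel₀ _ g1]
        ring
    · change s (extHom K Polynomial.X) = T
      rw [extHom_X]; simp [u, s]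
  intro p q h
  apply ha
  rw [← hs]
  simp [h]

theorem constHom_injective : Function.Injective (constHom K) := by
  intro p q h
  rw [← extHom_C, ← extHom_C] at h
  exact Polynomial.C_injective (extHom_injective K h)

theorem polyDer_u (i : Fin 3) : polyDer (δ₁₀ K) (u K i) = if i = 1 then u K 0 else 0 := by
  rw [u, polyDer, MvPolynomial.mkDerivation_X]
  fin_cases i <;> simp [Fin.sum_univ_three, δ₁₀, u]

theorem polyDer_v (i : Fin 3) : polyDer (δ₁₀ K) (v K i) = if i = 1 then v K 0 else 0 := by
  rw [v, polyDer, MvPolynomial.mkDerivation_X]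
  fin_cases i <;> simp [Fin.sum_univ_three, δ₁₀, v]

variable {K}

theorem mem_polyConst {p : UV K 3} : p ∈ polyConst (δ₁₀ K) ↔ polyDer (δ₁₀ K) p = 0 := Iff.rfl

variable (K) in
theorem constGen_mem (i : Fin 5) : constGen K i ∈ polyConst (δ₁₀ K) := by
  rw [mem_polyConst]
  fin_cases i <;> simp [constGen, detUV, polyDer_u, polyDer_v, Derivation.leibniz]
  ring

theorem constHom_mem (p : MvPolynomial (Fin 5) K) : constHom K p ∈ polyConst (δ₁₀ K) := by
  induction p using MvPolynomial.induction_on with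
  | C r => rw [← MvPolynomial.algebraMap_eq, AlgHom.commutes]; exact Subalgebra.algebraMap_mem _ _
  | add p q hp hq => rw [map_add]; exact add_mem hp hq
  | mul_X p i hp => rw [map_mul, constHom_X]; exact mul_mem hp (constGen_mem K i)

/-- Coefficients go to constants and the extra variable goes to `u₂`, with `δ(u₂) = u₁`; hence `δ`
acts as `u₁` times the formal derivative. -/
theorem polyDer_extHom (p : Polynomial (MvPolynomial (Fin 5) K)) :
    polyDer (δ₁₀ K) (extHom K p) = u K 0 * extHom K (Polynomial.derivative p) := by
  induction p using Polynomial.induction_on' with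
  | add p q hp hq => simp only [map_add, hp, hq, mul_add]
  | monomial n a =>
    have h0 : polyDer (δ₁₀ K) (constHom K a) = 0 := constHom_mem a
    rw [← Polynomial.C_mul_X_pow_eq_monomial, Polynomial.derivative_C_mul_X_pow]
    simp only [map_mul, map_pow, extHom_C, extHom_X, Derivation.leibniz, Derivation.leibniz_pow,
      polyDer_u, h0, map_natCast]
    simp
    ring

/-- Only `v₂` is not visibly in the image of `extHom`, and `u₁v₂ = det + u₂v₁` is. Spending one
factor `u₁` on every variable keeps the induction uniform. -/
theorem exists_u_pow_mul_eq_extHom (p : UV K 3) :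
    ∃ (n : ℕ) (q : Polynomial (MvPolynomial (Fin 5) K)), u K 0 ^ n * p = extHom K q := by
  have hu : extHom K (Polynomial.C (MvPolynomial.X 1)) = u K 0 := by
    rw [extHom_C, constHom_X]; rfl
  induction p using MvPolynomial.induction_on with
  | C r =>
    refine ⟨0, Polynomial.C (MvPolynomial.C r), ?_⟩
    rw [extHom_C, ← MvPolynomial.algebraMap_eq, ← MvPolynomial.algebraMap_eq, AlgHom.commutes]
    simp
  | add p q hp hq =>
    obtain ⟨n, p', hp⟩ := hp
    obtain ⟨m, q', hq⟩ := hq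
    refine ⟨n + m, Polynomial.C (MvPolynomial.X 1) ^ m * p' +
      Polynomial.C (MvPolynomial.X 1) ^ n * q', ?_⟩
    simp only [map_add, map_mul, map_pow, hu, ← hp, ← hq]
    ring
  | mul_X p i hp =>
    obtain ⟨n, p', hp⟩ := hp
    suffices h : ∃ q, u K 0 * MvPolynomial.X i = extHom K q by
      obtain ⟨q, hq⟩ := h
      refine ⟨n + 1, p' * q, ?_⟩
      rw [map_mul, ← hp, ← hq]; ring
    have hX : ∀ j i, constGen K j = MvPolynomial.X i →
        ∃ q, u K 0 * MvPolynomial.X i = extHom K q := by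
      intro j i h
      refine ⟨Polynomial.C (MvPolynomial.X 1) * Polynomial.C (MvPolynomial.X j), ?_⟩
      rw [map_mul, hu, extHom_C, constHom_X, h]
    rcases i with i | i <;> fin_cases i
    · exact hX 1 _ rfl
    · exact ⟨Polynomial.C (MvPolynomial.X 1) * Polynomial.X, by rw [map_mul, hu, extHom_X]; rfl⟩
    · exact hX 3 _ rfl
    · exact hX 0 _ rfl
    · refine ⟨Polynomial.C (MvPolynomial.X 2) + Polynomial.X * Polynomial.C (MvPolynomial.X 0), ?_⟩
      simp only [map_add, map_mul, extHom_X, extHom_C, constHom_X]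
      change u K 0 * v K 1 = detUV K + u K 1 * v K 0
      rw [detUV]; ring
    · exact hX 4 _ rfl

/-- The substitution `X i = 0`. -/
def killVar {σ : Type*} [DecidableEq σ] (i : σ) : MvPolynomial σ K →ₐ[K] MvPolynomial σ K :=
  MvPolynomial.aeval (Function.update MvPolynomial.X i 0)

theorem X_dvd_sub_killVar {σ : Type*} [DecidableEq σ] (i : σ) (p : MvPolynomial σ K) :
    MvPolynomial.X i ∣ p - killVar i p := by
  induction p using MvPolynomial.induction_on with
  | C r => simp [killVar, ← MvPolynomial.algebraMap_eq]
  | add p q hp hq =>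
    rw [map_add, add_sub_add_comm]; exact dvd_add hp hq
  | mul_X p j hp =>
    have e : p * MvPolynomial.X j - killVar i (p * MvPolynomial.X j) =
        (p - killVar i p) * MvPolynomial.X j +
          killVar i p * (MvPolynomial.X j - killVar i (MvPolynomial.X j)) := by
      rw [map_mul]; ring
    rw [e]
    refine dvd_add (hp.mul_right _) (Dvd.dvd.mul_left ?_ _)
    by_cases h : j = i
    · subst h; simp [killVar]
    · simp [killVar, h]

theorem X_dvd_of_killVar {σ : Type*} [DecidableEq σ] {i : σ} {p : MvPolynomial σ K}
    (h : killVar i p = 0) : MvPolynomial.X i ∣ p := by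
  simpa [h] using X_dvd_sub_killVar i p

variable (K) in
theorem killVar_X_self {σ : Type*} [DecidableEq σ] (i : σ) :
    killVar i (MvPolynomial.X i : MvPolynomial σ K) = 0 := by simp [killVar]

variable (K) in
theorem killVar_X_of_ne {σ : Type*} [DecidableEq σ] {i j : σ} (h : j ≠ i) :
    killVar i (MvPolynomial.X j : MvPolynomial σ K) = MvPolynomial.X j := by simp [killVar, h]

/-- At `u₁ = 0` the generators become `v₁, 0, -u₂v₁, u₃, v₃`, and the four nonzero ones are
algebraically independent. The substitution `s` recovers them by sending `u₂` to `-g 2 / g 0`. -/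
theorem killVar_eq_zero_of_killVar_constHom_u {p : MvPolynomial (Fin 5) K}
    (h : killVar (Sum.inl 0) (constHom K p) = 0) : killVar 1 p = 0 := by
  obtain ⟨F, _, _, a, ha⟩ := exists_injective_algHom_field K (MvPolynomial (Fin 5) K)
  obtain ⟨g, hg⟩ : ∃ g : Fin 5 → F, ∀ i, a (MvPolynomial.X i) = g i := ⟨_, fun _ => rfl⟩
  have g0 : g 0 ≠ 0 := by
    intro h
    rw [← hg, ← map_zero a] at h
    exact MvPolynomial.X_ne_zero (R := K) (0 : Fin 5) (ha h)
  let s : UV K 3 →ₐ[K] F := MvPolynomial.aeval (Sum.elim ![0, - g 2 / g 0, g 3] ![g 0, 0, g 4])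
  have hs : (s.comp ((killVar (Sum.inl 0)).comp (constHom K))) =
      a.comp (killVar 1) := by
    refine MvPolynomial.algHom_ext fun i => ?_
    fin_cases i <;> simp [constHom, constGen, detUV, u, v, s, killVar, hg, Function.update]
    field_simp
  apply ha
  have := DFunLike.congr_fun hs p
  simpa [h] using this.symm

/-- At `v₁ = 0` the generators become `0, u₁, u₁v₂, u₃, v₃`. Multiplying the hypothesis by `u₁`
turns `v₂` into the generator `u₁v₂`, so the condition can be read in the five parameters. -/
theorem killVar_eq_zero_of_killVar_constHom_v {p q : MvPolynomial (Fin 5) K}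
    (h : killVar (Sum.inr 0) (constHom K p * v K 1 + constHom K q * v K 2) = 0) :
    killVar 0 (p * MvPolynomial.X 2 + q * (MvPolynomial.X 1 * MvPolynomial.X 4)) = 0 := by
  obtain ⟨F, _, _, a, ha⟩ := exists_injective_algHom_field K (MvPolynomial (Fin 5) K)
  obtain ⟨g, hg⟩ : ∃ g : Fin 5 → F, ∀ i, a (MvPolynomial.X i) = g i := ⟨_, fun _ => rfl⟩
  have g1 : g 1 ≠ 0 := by
    intro h
    rw [← hg, ← map_zero a] at h
    exact MvPolynomial.X_ne_zero (R := K) (1 : Fin 5) (ha h)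
  let s : UV K 3 →ₐ[K] F := MvPolynomial.aeval (Sum.elim ![g 1, 0, g 3] ![0, g 2 / g 1, g 4])
  have hs : (s.comp ((killVar (Sum.inr 0)).comp (constHom K))) =
      a.comp (killVar 0) := by
    refine MvPolynomial.algHom_ext fun i => ?_
    fin_cases i <;> simp [constHom, constGen, detUV, u, v, s, killVar, hg, Function.update]
    field_simp
  apply ha
  have hp := DFunLike.congr_fun hs p
  have hq := DFunLike.congr_fun hs q
  have h' := congrArg s h
  have e1 : s (killVar (Sum.inr 0) (v K 1)) = g 2 / g 1 := by simp [s, killVar, v]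
  have e2 : s (killVar (Sum.inr 0) (v K 2)) = g 4 := by simp [s, killVar, v]
  have e3 : ∀ j : Fin 5, j ≠ 0 → a (killVar 0 (MvPolynomial.X j)) = g j := by
    intro j hj; rw [killVar_X_of_ne _ hj, hg]
  simp only [AlgHom.comp_apply] at hp hq
  rw [map_add, map_mul, map_mul, map_add, map_mul, map_mul, hp, hq, e1, e2, map_zero] at h'
  simp only [map_add, map_mul]
  rw [e3 _ (by decide), e3 _ (by decide), e3 _ (by decide), map_zero]
  field_simp at h'
  linear_combination h'

theorem mem_polyConst_of_mul {a p : UV K 3} (ha : a ∈ polyConst (δ₁₀ K)) (h0 : a ≠ 0)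
    (h : a * p ∈ polyConst (δ₁₀ K)) : p ∈ polyConst (δ₁₀ K) := by
  rw [mem_polyConst] at *
  rw [Derivation.leibniz, ha] at h
  simpa [h0] using h

variable (K) in
theorem u_ne_zero (i : Fin 3) : u K i ≠ 0 := MvPolynomial.X_ne_zero _
variable (K) in
theorem v_ne_zero (i : Fin 3) : v K i ≠ 0 := MvPolynomial.X_ne_zero _

/-- The algebra of constants of `δ(1,0)` is generated by `v₁, u₁, u₁ v₂ - u₂ v₁, u₃, v₃`. -/
theorem exists_constHom_eq [CharZero K] {p : UV K 3} (hp : p ∈ polyConst (δ₁₀ K)) :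
    ∃ q, constHom K q = p := by
  obtain ⟨n, q, hq⟩ := exists_u_pow_mul_eq_extHom p
  have hu : polyDer (δ₁₀ K) (u K 0) = 0 := by simp [polyDer_u]
  have hd : u K 0 * extHom K (Polynomial.derivative q) = 0 := by
    rw [← polyDer_extHom, ← hq, Derivation.leibniz, Derivation.leibniz_pow, mem_polyConst.1 hp, hu]
    simp
  have hq' : Polynomial.derivative q = 0 := by
    apply extHom_injective K
    rw [map_zero]
    exact (mul_eq_zero.1 hd).resolve_left (u_ne_zero K 0)
  -- Characteristic 0 is used here: a polynomial with zero derivative is a constant.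
  rw [Polynomial.eq_C_of_natDegree_eq_zero (Polynomial.derivative_eq_zero.1 hq'),
    extHom_C] at hq
  generalize q.coeff 0 = q at hq
  clear hq' hd
  -- The factors `u₁` are cancelled one at a time: a positive power of `u₁` vanishes at `u₁ = 0`, so
  -- `X 1` divides `q`.
  induction n generalizing q with
  | zero => exact ⟨q, by simpa using hq.symm⟩
  | succ n ih =>
    obtain ⟨r, rfl⟩ : MvPolynomial.X 1 ∣ q := by
      apply X_dvd_of_killVar
      apply killVar_eq_zero_of_killVar_constHom_u
      rw [← hq, map_mul, map_pow, u, killVar_X_self]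
      simp
    refine ih r (mul_left_cancel₀ (u_ne_zero K 0) ?_)
    rw [map_mul, constHom_X] at hq
    rw [← mul_assoc, ← pow_succ', hq]; rfl

end PolynomialConstants

/-! ### Generators of the commutator ideal and Fox derivatives on it. -/

section CommutatorIdeal

variable {K : Type*} [Field K] {d : ℕ}

theorem FAlg.induction {C : FAlg K d → Prop} (hr : ∀ r, C (algebraMap K _ r)) (hx : ∀ i, C (x K d i))
    (hmul : ∀ a b, C a → C b → C (a * b)) (hadd : ∀ a b, C a → C b → C (a + b)) (a : FAlg K d) :
    C a := by
  obtain ⟨a, rfl⟩ := mk_surjective a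
  induction a using FreeAlgebra.induction with
  | grade0 r => rw [AlgHom.commutes]; exact hr r
  | grade1 i => exact hx i
  | mul a b ha hb => rw [map_mul]; exact hmul _ _ ha hb
  | add a b ha hb => rw [map_add]; exact hadd _ _ ha hb

variable (K d) in
/-- The `K[U_d, V_d]`-submodule of `F_d'` generated by the commutators `[x_i, x_j]`. -/
def bracketSpan : Submodule (UV K d) (commIdeal K d) :=
  Submodule.span _ {f | ∃ i j, f = ⟨⁅x K d i, x K d j⁆, bracket_mem_commIdeal _ _⟩}

-- The span is a two-sided ideal, since left multiplication by `x_i` is the action of `u_i` and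
-- right multiplication is that of `u_i + v_i`. The Leibniz rule in each argument then reduces every
-- commutator to commutators of generators.
variable (K d) in
theorem bracketSpan_eq_top : bracketSpan K d = ⊤ := by
  let S : Submodule K (FAlg K d) := ((bracketSpan K d).restrictScalars K).map (commIdeal K d).subtype
  have hl : ∀ a, ∀ y ∈ S, a * y ∈ S := by
    intro a
    induction a using FAlg.induction with
    | hr r => intro y hy; rw [← Algebra.smul_def]; exact S.smul_mem _ hy
    | hx i =>
      rintro _ ⟨m, hm, rfl⟩
      exact ⟨(MvPolynomial.X (Sum.inl i) : UV K d) • m, (bracketSpan K d).smul_mem _ hm,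
        coe_u_smul i m⟩
    | hmul a b ha hb => intro y hy; rw [mul_assoc]; exact ha _ (hb _ hy)
    | hadd a b ha hb => intro y hy; rw [add_mul]; exact add_mem (ha _ hy) (hb _ hy)
  have hr : ∀ a, ∀ y ∈ S, y * a ∈ S := by
    intro a
    induction a using FAlg.induction with
    | hr r => intro y hy; rw [← Algebra.commutes, ← Algebra.smul_def]; exact S.smul_mem _ hy
    | hx i =>
      rintro _ ⟨m, hm, rfl⟩
      refine ⟨(MvPolynomial.X (Sum.inl i) : UV K d) • m + (MvPolynomial.X (Sum.inr i) : UV K d) • m,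
        add_mem ((bracketSpan K d).smul_mem _ hm) ((bracketSpan K d).smul_mem _ hm), ?_⟩
      rw [map_add]
      simp only [Submodule.subtype_apply, coe_u_smul, coe_v_smul, Ring.lie_def]
      abel
    | hmul a b ha hb => intro y hy; rw [← mul_assoc]; exact hb _ (ha _ hy)
    | hadd a b ha hb => intro y hy; rw [mul_add]; exact add_mem (ha _ hy) (hb _ hy)
  have h1 : ∀ i g, ⁅x K d i, g⁆ ∈ S := by
    intro i g
    induction g using FAlg.induction with
    | hr r => simp [Ring.lie_def, Algebra.commutes]
    | hx j => exact ⟨_, Submodule.subset_span ⟨i, j, rfl⟩, rfl⟩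
    | hmul a b ha hb =>
      have e : ⁅x K d i, a * b⁆ = ⁅x K d i, a⁆ * b + a * ⁅x K d i, b⁆ := by
        simp only [Ring.lie_def]; noncomm_ring
      rw [e]; exact add_mem (hr _ _ ha) (hl _ _ hb)
    | hadd a b ha hb =>
      have e : ⁅x K d i, a + b⁆ = ⁅x K d i, a⁆ + ⁅x K d i, b⁆ := by
        simp only [Ring.lie_def]; noncomm_ring
      rw [e]; exact add_mem ha hb
  have h2 : ∀ f g : FAlg K d, ⁅f, g⁆ ∈ S := by
    intro f g
    induction f using FAlg.induction with
    | hr r => simp [Ring.lie_def, Algebra.commutes]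
    | hx j => exact h1 j g
    | hmul a b ha hb =>
      have e : ⁅a * b, g⁆ = ⁅a, g⁆ * b + a * ⁅b, g⁆ := by
        simp only [Ring.lie_def]; noncomm_ring
      rw [e]; exact add_mem (hr _ _ ha) (hl _ _ hb)
    | hadd a b ha hb =>
      have e : ⁅a + b, g⁆ = ⁅a, g⁆ + ⁅b, g⁆ := by
        simp only [Ring.lie_def]; noncomm_ring
      rw [e]; exact add_mem ha hb
  have h3 : commIdeal K d ≤ S := by
    refine Submodule.span_le.2 ?_
    rintro _ ⟨a, f, g, b, rfl⟩
    exact hr _ _ (hl _ _ (h2 f g))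
  rw [eq_top_iff]
  rintro f -
  obtain ⟨m, hm, e⟩ := h3 f.2
  rwa [← Subtype.ext e]

variable (K) in
/-- The image of `x_i` in the representation of `F_d` by upper triangular matrices whose
off-diagonal entry is the `k`-th Fox derivative. -/
def foxGen (k i : Fin d) : Matrix (Fin 2) (Fin 2) (UV K d) :=
  !![MvPolynomial.X (Sum.inl i), if i = k then 1 else 0;
    0, MvPolynomial.X (Sum.inl i) + MvPolynomial.X (Sum.inr i)]

theorem lift_foxGen_apply_one_zero (k : Fin d) (f : FreeAlgebra K (Fin d)) :
    FreeAlgebra.lift K (foxGen K k) f 1 0 = 0 := by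
  induction f using FreeAlgebra.induction with
  | grade0 r => rw [AlgHom.commutes, Matrix.algebraMap_matrix_apply]; simp
  | grade1 i => simp [foxGen]
  | mul a b ha hb => rw [map_mul, Matrix.mul_apply]; simp [Fin.sum_univ_two, ha, hb]
  | add a b ha hb => rw [map_add, Matrix.add_apply, ha, hb, add_zero]

/-- Commutators of upper triangular matrices over a commutative ring are strictly upper triangular,
and two such 2 by 2 matrices have product zero. -/
theorem bracket_mul_bracket_of_upper {R : Type*} [CommRing R] {A B C D : Matrix (Fin 2) (Fin 2) R}
    (hA : A 1 0 = 0) (hB : B 1 0 = 0) (hC : C 1 0 = 0) (hD : D 1 0 = 0) :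
    (A * B - B * A) * (C * D - D * C) = 0 := by
  have key : ∀ {A B : Matrix (Fin 2) (Fin 2) R}, A 1 0 = 0 → B 1 0 = 0 → (A * B - B * A) 1 0 = 0 ∧
      (A * B - B * A) 0 0 = 0 ∧ (A * B - B * A) 1 1 = 0 := by
    intro A B hA hB
    simp [Matrix.mul_apply, Fin.sum_univ_two, hA, hB, mul_comm]
  obtain ⟨h1, h2, h3⟩ := key hA hB
  obtain ⟨h4, h5, h6⟩ := key hC hD
  generalize A * B - B * A = M at *
  generalize C * D - D * C = N at *
  ext i j
  fin_cases i <;> fin_cases j <;> simp [Matrix.mul_apply, Fin.sum_univ_two, *]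

theorem lift_foxGen_rel (k : Fin d) ⦃f g : FreeAlgebra K (Fin d)⦄ (h : MetabelianRel K d f g) :
    FreeAlgebra.lift K (foxGen K k) f = FreeAlgebra.lift K (foxGen K k) g := by
  obtain ⟨f, g, h, k'⟩ := h
  simp only [map_mul, map_sub, map_zero]
  apply bracket_mul_bracket_of_upper <;> exact lift_foxGen_apply_one_zero _ _

/-- The representation of `F_d` by upper triangular matrices with diagonal entries
`x_i ↦ u_i, u_i + v_i`. -/
def foxHom (k : Fin d) : FAlg K d →ₐ[K] Matrix (Fin 2) (Fin 2) (UV K d) :=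
  RingQuot.liftAlgHom K ⟨FreeAlgebra.lift K (foxGen K k), lift_foxGen_rel k⟩

theorem foxHom_mk (k : Fin d) (f : FreeAlgebra K (Fin d)) :
    foxHom k (mk K d f) = FreeAlgebra.lift K (foxGen K k) f :=
  RingQuot.liftAlgHom_mkAlgHom_apply K _ (lift_foxGen_rel k) _

theorem foxHom_x (k i : Fin d) : foxHom k (x K d i) = foxGen K k i := by
  rw [x, foxHom_mk, FreeAlgebra.lift_ι_apply]

theorem foxHom_apply_one_zero (k : Fin d) (f : FAlg K d) : foxHom k f 1 0 = 0 := by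
  obtain ⟨f, rfl⟩ := mk_surjective f
  rw [foxHom_mk, lift_foxGen_apply_one_zero]

theorem foxHom_diag_of_mem (k : Fin d) {f : FAlg K d} (hf : f ∈ commIdeal K d) :
    foxHom k f 0 0 = 0 ∧ foxHom k f 1 1 = 0 := by
  induction hf using Submodule.span_induction with
  | mem y hy =>
    obtain ⟨a, f, g, b, rfl⟩ := hy
    simp [Ring.lie_def, Matrix.mul_apply, Fin.sum_univ_two, foxHom_apply_one_zero, mul_comm]
  | zero => simp
  | add y z _ _ hy hz => simp [hy, hz]
  | smul r y _ hy => simp [hy]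

/-- The `k`-th Fox derivative on `F_d`. -/
def fox (k : Fin d) : FAlg K d →ₗ[K] UV K d :=
  (Matrix.entryLinearMap K (UV K d) 0 1).comp (foxHom k).toLinearMap

theorem fox_apply (k : Fin d) (f : FAlg K d) : fox k f = foxHom k f 0 1 := rfl

theorem fox_x_mul (k i : Fin d) {f : FAlg K d} (hf : f ∈ commIdeal K d) :
    fox k (x K d i * f) = MvPolynomial.X (Sum.inl i) * fox k f := by
  have := foxHom_diag_of_mem k hf
  simp [fox_apply, foxHom_x, foxGen, Matrix.mul_apply, Fin.sum_univ_two, this]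

theorem fox_mul_x (k i : Fin d) {f : FAlg K d} (hf : f ∈ commIdeal K d) :
    fox k (f * x K d i) =
      (MvPolynomial.X (Sum.inl i) + MvPolynomial.X (Sum.inr i)) * fox k f := by
  have := foxHom_diag_of_mem k hf
  simp [fox_apply, foxHom_x, foxGen, Matrix.mul_apply, Fin.sum_univ_two, this, mul_comm]

/-- The diagonal vanishes on the commutator ideal, so the twisted Leibniz rule loses a term:
multiplying by `x_i` scales the corner entry by `u_i` on the left and by `u_i + v_i` on the right.
The difference is `v_i`. -/
theorem fox_smul (k : Fin d) (p : UV K d) (f : commIdeal K d) :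
    fox k (p • f : commIdeal K d) = p * fox k f := by
  induction p using MvPolynomial.induction_on generalizing f with
  | C r => rw [C_smul, Submodule.coe_smul, map_smul, MvPolynomial.smul_eq_C_mul]
  | add p q hp hq => rw [add_smul, Submodule.coe_add, map_add, hp, hq, add_mul]
  | mul_X p s hp =>
    rw [mul_smul, hp]
    rcases s with i | i
    · rw [coe_u_smul, fox_x_mul _ _ f.2]; ring
    · rw [coe_v_smul, Ring.lie_def, map_sub, fox_x_mul _ _ f.2, fox_mul_x _ _ f.2]; ring

theorem fox_bracket_x (k i j : Fin d) : fox k ⁅x K d i, x K d j⁆ =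
    (if i = k then MvPolynomial.X (Sum.inr j) else 0) -
      (if j = k then MvPolynomial.X (Sum.inr i) else 0) := by
  simp only [Ring.lie_def, map_sub, fox_apply, map_mul, foxHom_x, foxGen]
  simp [Matrix.mul_apply, Fin.sum_univ_two]
  split_ifs <;> ring

end CommutatorIdeal

/-! ### The embedding of `F_3'` into pairs of polynomials. -/

section RankThree

variable (K : Type*) [Field K]

/-- The commutator `[x_i, x_j]` as an element of `F_3'`. -/
def brk (i j : Fin 3) : commIdeal K 3 := ⟨⁅x K 3 i, x K 3 j⁆, bracket_mem_commIdeal _ _⟩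

theorem brk_self (i : Fin 3) : brk K i i = 0 := Subtype.ext (sub_self _)

theorem brk_skew (i j : Fin 3) : brk K j i = -brk K i j :=
  Subtype.ext (neg_sub _ _).symm

theorem fox_brk (k i j : Fin 3) : fox k (brk K i j : FAlg K 3) =
    (if i = k then v K j else 0) - (if j = k then v K i else 0) := fox_bracket_x k i j

theorem brk_jacobi : v K 0 • brk K 1 2 + v K 1 • brk K 2 0 + v K 2 • brk K 0 1 = 0 := by
  apply Subtype.ext
  simp only [Submodule.coe_add, v, coe_v_smul, brk, Ring.lie_def, ZeroMemClass.coe_zero]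
  noncomm_ring

variable {K}

theorem exists_eq_smul_brk (f : commIdeal K 3) :
    ∃ p : Fin 3 → UV K 3, f = p 0 • brk K 1 2 + p 1 • brk K 2 0 + p 2 • brk K 0 1 := by
  have hf : f ∈ bracketSpan K 3 := by rw [bracketSpan_eq_top]; trivial
  induction hf using Submodule.span_induction with
  | mem f hf =>
    obtain ⟨i, j, rfl⟩ := hf
    change ∃ p : Fin 3 → UV K 3, brk K i j = _
    have h0 : ∃ p : Fin 3 → UV K 3,
        (0 : commIdeal K 3) = p 0 • brk K 1 2 + p 1 • brk K 2 0 + p 2 • brk K 0 1 := ⟨0, by simp⟩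
    fin_cases i <;> fin_cases j
    · exact (brk_self K 0) ▸ h0
    · exact ⟨![0, 0, 1], by simp⟩
    · exact ⟨![0, -1, 0], by simp [brk_skew K 2 0]⟩
    · exact ⟨![0, 0, -1], by simp [brk_skew K 0 1]⟩
    · exact (brk_self K 1) ▸ h0
    · exact ⟨![1, 0, 0], by simp⟩
    · exact ⟨![0, 1, 0], by simp⟩
    · exact ⟨![-1, 0, 0], by simp [brk_skew K 1 2]⟩
    · exact (brk_self K 2) ▸ h0
  | zero => exact ⟨0, by simp⟩
  | add f g _ _ hf hg =>
    obtain ⟨p, rfl⟩ := hf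
    obtain ⟨q, rfl⟩ := hg
    exact ⟨p + q, by simp only [Pi.add_apply, add_smul]; abel⟩
  | smul r f _ hf =>
    obtain ⟨p, rfl⟩ := hf
    exact ⟨r • p, by simp only [Pi.smul_apply, smul_eq_mul, mul_smul, smul_add]⟩

theorem fox_one_smul_brk (p : Fin 3 → UV K 3) :
    fox 1 (p 0 • brk K 1 2 + p 1 • brk K 2 0 + p 2 • brk K 0 1 : commIdeal K 3) =
      p 0 * v K 2 - p 2 * v K 0 := by
  simp only [Submodule.coe_add, map_add, fox_smul, fox_brk]
  simp
  ring

theorem fox_two_smul_brk (p : Fin 3 → UV K 3) :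
    fox 2 (p 0 • brk K 1 2 + p 1 • brk K 2 0 + p 2 • brk K 0 1 : commIdeal K 3) =
      p 1 * v K 0 - p 0 * v K 1 := by
  simp only [Submodule.coe_add, map_add, fox_smul, fox_brk]
  simp
  ring

theorem prime_v (i : Fin 3) : Prime (v K i) := MvPolynomial.X_prime

theorem not_v_zero_dvd_v_one : ¬ v K 0 ∣ v K 1 := by
  simp [v, MvPolynomial.X_dvd_X]

/-- The vanishing of both derivatives forces `v₁ ∣ p 0`, because `v₁` is prime and does not divide
`v₂`. Then the coefficients are `q • (v₁, v₂, v₃)`, a multiple of the Jacobi identity. -/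
theorem eq_zero_of_fox_eq_zero {f : commIdeal K 3} (h1 : fox 1 (f : FAlg K 3) = 0)
    (h2 : fox 2 (f : FAlg K 3) = 0) : f = 0 := by
  obtain ⟨p, rfl⟩ := exists_eq_smul_brk f
  rw [fox_one_smul_brk] at h1
  rw [fox_two_smul_brk] at h2
  obtain ⟨q, hq⟩ : v K 0 ∣ p 0 :=
    ((prime_v 0).dvd_or_dvd (Dvd.intro_left (p 1) (sub_eq_zero.1 h2))).resolve_right
      not_v_zero_dvd_v_one
  have e1 : p 1 = q * v K 1 := mul_right_cancel₀ (v_ne_zero K 0) (by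
    linear_combination h2 + v K 1 * hq)
  have e2 : p 2 = q * v K 2 := mul_right_cancel₀ (v_ne_zero K 0) (by
    linear_combination -h1 + v K 2 * hq)
  rw [hq, e1, e2, mul_comm (v K 0) q, mul_smul, mul_smul, mul_smul, ← smul_add, ← smul_add,
    brk_jacobi, smul_zero]

/-- In this combination the terms with `p 0` cancel. This is the constraint on the image of the
embedding that determines the generators. -/
theorem v_zero_dvd_fox (f : commIdeal K 3) :
    v K 0 ∣ fox 1 (f : FAlg K 3) * v K 1 + fox 2 (f : FAlg K 3) * v K 2 := by
  obtain ⟨p, rfl⟩ := exists_eq_smul_brk f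
  rw [fox_one_smul_brk, fox_two_smul_brk]
  exact ⟨p 1 * v K 2 - p 2 * v K 1, by ring⟩

/-- The Fox derivatives with respect to `x₂` and `x₃` commute with `δ(1,0)` on `F_3'`. -/
theorem fox_der (f : commIdeal K 3) {k : Fin 3} (hk : k ≠ 0) :
    fox k (der (δ₁₀ K) f) = polyDer (δ₁₀ K) (fox k (f : FAlg K 3)) := by
  have key : ∀ (p : UV K 3) (i j : Fin 3), fox k (der (δ₁₀ K) (p • brk K i j : commIdeal K 3)) =
      polyDer (δ₁₀ K) (fox k (p • brk K i j : commIdeal K 3)) := by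
    intro p i j
    rw [der_smul, map_add, fox_smul, fox_smul, fox_smul, Derivation.leibniz, smul_eq_mul,
      smul_eq_mul, add_comm, mul_comm (fox k _)]
    congr 2
    change fox k (der (δ₁₀ K) ⁅x K 3 i, x K 3 j⁆) = _
    have hx : ∀ j, der (δ₁₀ K) (x K 3 j) = if j = 1 then x K 3 0 else 0 := by
      intro j
      rw [der_x]
      fin_cases j <;> simp [Fin.sum_univ_three, δ₁₀]
    rw [der_bracket, hx, hx, fox_brk, map_sub]
    have hl : ∀ f : FAlg K 3, ⁅(0 : FAlg K 3), f⁆ = 0 := fun f => by simp [Ring.lie_def]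
    have hr : ∀ f : FAlg K 3, ⁅f, (0 : FAlg K 3)⁆ = 0 := fun f => by simp [Ring.lie_def]
    have hv : ∀ i, polyDer (δ₁₀ K) (MvPolynomial.X (Sum.inr i)) =
      if i = 1 then MvPolynomial.X (Sum.inr 0) else 0 := polyDer_v K
    -- For `k = 0` the identity fails: `δ(x₂) = x₁` contributes an extra term to the derivative with
    -- respect to `x₁`.
    fin_cases k <;> fin_cases i <;> fin_cases j <;>
      simp [fox_bracket_x, hv, hl, hr, v] at hk ⊢
  obtain ⟨p, rfl⟩ := exists_eq_smul_brk f
  simp only [Submodule.coe_add, map_add, key]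

end RankThree

/-! ### Generators and relations of the module of constants. -/

section Generators

variable {K : Type*} [Field K]

variable (K) in
theorem c₃_eq : c₃ K = u K 0 • brk K 2 1 - u K 1 • brk K 2 0 := by
  apply Subtype.ext
  rw [AddSubgroupClass.coe_sub, u, u, coe_u_smul, coe_u_smul]
  rfl

theorem fox_one_comb (p q r : UV K 3) :
    fox 1 (p • c₁ K + q • c₂ K + r • c₃ K : commIdeal K 3) = p * v K 0 - r * (u K 0 * v K 2) := by
  change fox 1 ((p • brk K 1 0 + q • brk K 2 0 + r • c₃ K : commIdeal K 3) : FAlg K 3) = _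
  rw [c₃_eq]
  simp only [Submodule.coe_add, AddSubgroupClass.coe_sub, smul_sub, map_add, map_sub, fox_smul,
    fox_brk]
  simp
  ring

theorem fox_two_comb (p q r : UV K 3) :
    fox 2 (p • c₁ K + q • c₂ K + r • c₃ K : commIdeal K 3) = q * v K 0 + r * detUV K := by
  change fox 2 ((p • brk K 1 0 + q • brk K 2 0 + r • c₃ K : commIdeal K 3) : FAlg K 3) = _
  rw [c₃_eq]
  simp only [Submodule.coe_add, AddSubgroupClass.coe_sub, smul_sub, map_add, map_sub, fox_smul,
    fox_brk]
  simp [detUV]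
  ring

theorem eq_of_fox_eq {f g : commIdeal K 3} (h1 : fox 1 (f : FAlg K 3) = fox 1 (g : FAlg K 3))
    (h2 : fox 2 (f : FAlg K 3) = fox 2 (g : FAlg K 3)) : f = g := by
  rw [← sub_eq_zero]
  apply eq_zero_of_fox_eq_zero <;> rw [AddSubgroupClass.coe_sub, map_sub, sub_eq_zero] <;> assumption

/-- The two Fox derivatives commute with `δ` and are jointly injective, so being constant can be
tested on them. -/
theorem der_eq_zero_iff (f : commIdeal K 3) : der (δ₁₀ K) f = 0 ↔
    fox 1 (f : FAlg K 3) ∈ polyConst (δ₁₀ K) ∧ fox 2 (f : FAlg K 3) ∈ polyConst (δ₁₀ K) := by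
  rw [mem_polyConst, mem_polyConst, ← fox_der f (by decide), ← fox_der f (by decide)]
  constructor
  · intro h; simp [h]
  · rintro ⟨h1, h2⟩
    exact congrArg Subtype.val
      (eq_zero_of_fox_eq_zero (f := ⟨der (δ₁₀ K) f, der_mem _ f.2⟩) h1 h2)

theorem der_comb {p q r : UV K 3} (hp : p ∈ polyConst (δ₁₀ K)) (hq : q ∈ polyConst (δ₁₀ K))
    (hr : r ∈ polyConst (δ₁₀ K)) :
    der (δ₁₀ K) (p • c₁ K + q • c₂ K + r • c₃ K : commIdeal K 3) = 0 := by
  rw [der_eq_zero_iff, fox_one_comb, fox_two_comb]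
  have h := constGen_mem K
  exact ⟨sub_mem (mul_mem hp (h 0)) (mul_mem hr (mul_mem (h 1) (h 4))),
    add_mem (mul_mem hq (h 0)) (mul_mem hr (h 2))⟩

/-- `X 2` is coprime to `X 1 * X 4`, so the syzygies of this pair are the multiples of the obvious
one. -/
theorem exists_of_mul_X_two_add {a b : MvPolynomial (Fin 5) K}
    (h : a * MvPolynomial.X 2 + b * (MvPolynomial.X 1 * MvPolynomial.X 4) = 0) :
    ∃ g, a = g * (MvPolynomial.X 1 * MvPolynomial.X 4) ∧ b = -(g * MvPolynomial.X 2) := by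
  have hX : ∀ i, i ≠ 2 → ∀ c : MvPolynomial (Fin 5) K, MvPolynomial.X i ∣ c * MvPolynomial.X 2 →
      MvPolynomial.X i ∣ c := by
    intro i hi c hc
    refine ((MvPolynomial.X_prime (R := K) (i := i)).dvd_or_dvd hc).resolve_right ?_
    simpa [MvPolynomial.X_dvd_X] using hi
  obtain ⟨a, rfl⟩ := hX 1 (by decide) a ⟨-(b * MvPolynomial.X 4), by linear_combination h⟩
  have h' : a * MvPolynomial.X 2 + b * MvPolynomial.X 4 = 0 :=
    (mul_eq_zero.1 (show MvPolynomial.X 1 * (a * MvPolynomial.X 2 + b * MvPolynomial.X 4) = 0 by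
      linear_combination h)).resolve_left (MvPolynomial.X_ne_zero _)
  obtain ⟨a, rfl⟩ := hX 4 (by decide) a ⟨-b, by linear_combination h'⟩
  refine ⟨a, by ring, ?_⟩
  have h'' : MvPolynomial.X 4 * (a * MvPolynomial.X 2 + b) = 0 := by linear_combination h'
  have := (mul_eq_zero.1 h'').resolve_left (MvPolynomial.X_ne_zero _)
  linear_combination this

theorem exists_comb_of_der_eq_zero [CharZero K] {f : commIdeal K 3} (hf : der (δ₁₀ K) f = 0) :
    ∃ p q r : MvPolynomial (Fin 5) K,
      f = constHom K p • c₁ K + constHom K q • c₂ K + constHom K r • c₃ K := by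
  obtain ⟨h1, h2⟩ := (der_eq_zero_iff f).1 hf
  obtain ⟨a, ha⟩ := exists_constHom_eq h1
  obtain ⟨b, hb⟩ := exists_constHom_eq h2
  -- The divisibility by `v₁` is read modulo `v₁`; it determines `a` and `b` modulo `X 0` up to the
  -- common factor `g`.
  have h : killVar (Sum.inr 0) (constHom K a * v K 1 + constHom K b * v K 2) = 0 := by
    obtain ⟨s, hs⟩ := v_zero_dvd_fox f
    rw [ha, hb, hs, map_mul, v, killVar_X_self, zero_mul]
  have h' := killVar_eq_zero_of_killVar_constHom_v h
  rw [map_add, map_mul, map_mul, map_mul, killVar_X_of_ne K (by decide),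
    killVar_X_of_ne K (by decide), killVar_X_of_ne K (by decide)] at h'
  obtain ⟨g, hg1, hg2⟩ := exists_of_mul_X_two_add h'
  obtain ⟨p, hp⟩ := X_dvd_sub_killVar 0 a
  obtain ⟨q, hq⟩ := X_dvd_sub_killVar 0 b
  rw [hg1, sub_eq_iff_eq_add] at hp
  rw [hg2, sub_eq_iff_eq_add] at hq
  -- The Fox derivatives of `c₃` are `-u₁v₃` and `det`, which explains the sign; `v₁p` and `v₁q` are
  -- supplied by `c₁` and `c₂`.
  refine ⟨p, q, -g, eq_of_fox_eq ?_ ?_⟩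
  · rw [fox_one_comb, ← ha, hp]
    simp only [map_add, map_mul, map_neg, constHom_X]
    change v K 0 * _ + _ * (u K 0 * v K 2) = _
    ring
  · rw [fox_two_comb, ← hb, hq]
    simp only [map_add, map_mul, map_neg, constHom_X]
    change v K 0 * _ + -(_ * detUV K) = _
    ring

theorem constModule_eq_span [CharZero K] : constModule (δ₁₀ K) =
    Submodule.span (polyConst (δ₁₀ K)) {c₁ K, c₂ K, c₃ K} := by
  apply le_antisymm
  · intro f hf
    obtain ⟨p, q, r, rfl⟩ := exists_comb_of_der_eq_zero hf
    have h : ∀ (p : MvPolynomial (Fin 5) K) {c : commIdeal K 3}, c ∈ ({c₁ K, c₂ K, c₃ K} : Set _) →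
        constHom K p • c ∈ Submodule.span (polyConst (δ₁₀ K)) {c₁ K, c₂ K, c₃ K} := fun p c hc =>
      Submodule.smul_mem _ (⟨constHom K p, constHom_mem p⟩ : polyConst (δ₁₀ K))
        (Submodule.subset_span hc)
    exact add_mem (add_mem (h p (by simp)) (h q (by simp))) (h r (by simp))
  · have h1 := one_mem (polyConst (δ₁₀ K))
    have h0 := zero_mem (polyConst (δ₁₀ K))
    rw [Submodule.span_le]
    rintro f (rfl | rfl | rfl)
    · change der (δ₁₀ K) (c₁ K) = 0
      simpa using der_comb h1 h0 h0
    · change der (δ₁₀ K) (c₂ K) = 0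
      simpa using der_comb h0 h1 h0
    · change der (δ₁₀ K) (c₃ K) = 0
      simpa using der_comb h0 h0 h1

variable (K) in
theorem generators_relation : (u K 0 * v K 2) • c₁ K - detUV K • c₂ K + v K 0 • c₃ K = 0 := by
  rw [sub_eq_add_neg, ← neg_smul]
  apply eq_zero_of_fox_eq_zero
  · rw [fox_one_comb]; ring
  · rw [fox_two_comb]; ring

variable (K) in
theorem generators_relation_brackets :
    x K 3 0 * ⁅⁅x K 3 1, x K 3 0⁆, x K 3 2⁆ -
      (x K 3 0 * ⁅⁅x K 3 2, x K 3 0⁆, x K 3 1⁆ - x K 3 1 * ⁅⁅x K 3 2, x K 3 0⁆, x K 3 0⁆) +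
      ⁅x K 3 0 * ⁅x K 3 2, x K 3 1⁆ - x K 3 1 * ⁅x K 3 2, x K 3 0⁆, x K 3 0⁆ = 0 := by
  have h := congrArg Subtype.val (generators_relation K)
  rw [detUV, sub_smul, mul_smul, mul_smul, mul_smul, Submodule.coe_add, AddSubgroupClass.coe_sub,
    AddSubgroupClass.coe_sub] at h
  simp only [u, v, coe_u_smul, coe_v_smul] at h
  exact h

/-- The first Fox derivative gives `p v₁ = r u₁v₃`. As `v₁` is prime and does not divide `u₁v₃`, it
divides `r`, and cancelling `v₁` determines `p` and `q`. -/
theorem exists_eq_mul_of_comb_eq_zero {p q r : UV K 3}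
    (h : p • c₁ K + q • c₂ K + r • c₃ K = 0) :
    ∃ s, p = s * (u K 0 * v K 2) ∧ q = -(s * detUV K) ∧ r = s * v K 0 := by
  have h1 := fox_one_comb p q r
  have h2 := fox_two_comb p q r
  rw [h, ZeroMemClass.coe_zero, map_zero] at h1 h2
  have hd : v K 0 ∣ r * (u K 0 * v K 2) := ⟨p, by linear_combination h1⟩
  obtain ⟨s, rfl⟩ : v K 0 ∣ r := by
    refine ((prime_v 0).dvd_or_dvd hd).resolve_right fun h => ?_
    rcases (prime_v 0).dvd_or_dvd h with h | h <;> simp [u, v, MvPolynomial.X_dvd_X] at h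
  refine ⟨s, ?_, ?_, mul_comm _ _⟩ <;> apply mul_right_cancel₀ (v_ne_zero K 0)
  · linear_combination -h1
  · linear_combination -h2

theorem exists_polyConst_of_comb_eq_zero {p q r : polyConst (δ₁₀ K)}
    (h : p • c₁ K + q • c₂ K + r • c₃ K = 0) :
    ∃ s : polyConst (δ₁₀ K), (p : UV K 3) = s * (u K 0 * v K 2) ∧
      (q : UV K 3) = -(s * detUV K) ∧ (r : UV K 3) = s * v K 0 := by
  obtain ⟨s, hp, hq, hr⟩ := exists_eq_mul_of_comb_eq_zero (p := (p : UV K 3)) (q := q) (r := r) h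
  -- The product `v₁ s` is the constant `r`, and a nonzero constant factor can be cancelled.
  have hs : s ∈ polyConst (δ₁₀ K) := by
    refine mem_polyConst_of_mul (constGen_mem K 0) (v_ne_zero K 0) ?_
    change v K 0 * s ∈ _
    rw [mul_comm, ← hr]; exact r.2
  exact ⟨⟨s, hs⟩, hp, hq, hr⟩

end Generators

/-! ### Generating functions that count exponent vectors by weight. -/

section CountSeries

variable {σ ι κ : Type*}

/-- The generating function of the number of indices of given degree. -/
def countSeries (deg : ι → σ →₀ ℕ) : MvPowerSeries σ ℤ := fun n => Nat.card {i // deg i = n}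

theorem coeff_countSeries (deg : ι → σ →₀ ℕ) (n : σ →₀ ℕ) :
    MvPowerSeries.coeff n (countSeries deg) = Nat.card {i // deg i = n} := rfl

theorem countSeries_comp_equiv (e : κ ≃ ι) (deg : ι → σ →₀ ℕ) :
    countSeries (deg ∘ e) = countSeries deg := by
  ext n
  rw [coeff_countSeries, coeff_countSeries]
  exact congrArg _ (Nat.card_congr (e.subtypeEquiv fun _ => Iff.rfl))

theorem finite_sumElim_eq {d : ι → σ →₀ ℕ} {e : κ → σ →₀ ℕ} (hd : ∀ n, Finite {i // d i = n})
    (he : ∀ n, Finite {i // e i = n}) (n : σ →₀ ℕ) : Finite {i // Sum.elim d e i = n} := by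
  have : Finite {i // Sum.elim d e (Sum.inl i) = n} := hd n
  have : Finite {i // Sum.elim d e (Sum.inr i) = n} := he n
  exact Finite.of_equiv _ Equiv.subtypeSum.symm

theorem countSeries_sum {d : ι → σ →₀ ℕ} {e : κ → σ →₀ ℕ} (hd : ∀ n, Finite {i // d i = n})
    (he : ∀ n, Finite {i // e i = n}) :
    countSeries (Sum.elim d e) = countSeries d + countSeries e := by
  ext n
  have : Finite {i // Sum.elim d e (Sum.inl i) = n} := hd n
  have : Finite {i // Sum.elim d e (Sum.inr i) = n} := he n
  rw [map_add, coeff_countSeries, coeff_countSeries, coeff_countSeries,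
    Nat.card_congr Equiv.subtypeSum, Nat.card_sum, Nat.cast_add]
  rfl

theorem finite_add_const {d : ι → σ →₀ ℕ} (hd : ∀ n, Finite {i // d i = n}) (s n : σ →₀ ℕ) :
    Finite {i // d i + s = n} := by
  have := hd (n - s)
  exact Finite.of_injective (β := {i // d i = n - s}) (fun i => ⟨i.1, eq_tsub_of_add_eq i.2⟩)
    fun a b h => Subtype.ext (congrArg (fun i => i.1) h)

theorem countSeries_add_const (d : ι → σ →₀ ℕ) (s : σ →₀ ℕ) :
    countSeries (fun i => d i + s) = MvPowerSeries.monomial s 1 * countSeries d := by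
  ext n
  rw [MvPowerSeries.coeff_monomial_mul, one_mul, coeff_countSeries, coeff_countSeries]
  split_ifs with h
  · have e : ∀ i, d i + s = n ↔ d i = n - s := fun i =>
      ⟨fun h => by rw [← h, add_tsub_cancel_right], fun h' => by rw [h', tsub_add_cancel_of_le h]⟩
    exact congrArg _ (Nat.card_congr (Equiv.subtypeEquivRight e))
  · have : IsEmpty {i // d i + s = n} := ⟨fun i => h (i.2 ▸ le_add_self)⟩
    simp

theorem finite_weight_eq {k : ℕ} {w : Fin k → σ →₀ ℕ} (hw : ∀ i, w i ≠ 0) (n : σ →₀ ℕ) :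
    Finite {m : Fin k →₀ ℕ // Finsupp.weight w m = n} := by
  have hw' : ∀ i, (w i).degree ≠ 0 := fun i => by simpa [Finsupp.degree_eq_zero_iff] using hw i
  refine ((Finsupp.finite_of_nat_weight_le (fun i => (w i).degree) hw' n.degree).subset ?_).to_subtype
  rintro m (rfl : Finsupp.weight w m = n)
  simp [Finsupp.weight_apply, Finsupp.sum_fintype]

theorem weight_fin_succ {k : ℕ} (w : Fin (k + 1) → σ →₀ ℕ) (m : Fin (k + 1) →₀ ℕ) :
    Finsupp.weight w m = m 0 • w 0 + Finsupp.weight (w ∘ Fin.succ) (Finsupp.tail m) := by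
  simp only [Finsupp.weight_apply, zero_smul, implies_true, Finsupp.sum_fintype,
    Fin.sum_univ_succ]
  rfl

/-- An exponent vector either has zero first entry, or arises uniquely from another one by raising
that entry by 1, which adds `w 0` to the weight. -/
theorem one_sub_mul_countSeries_weight {k : ℕ} {w : Fin (k + 1) → σ →₀ ℕ} (hw : ∀ i, w i ≠ 0) :
    (1 - MvPowerSeries.monomial (w 0) 1) * countSeries (Finsupp.weight (R := ℕ) w) =
      countSeries (Finsupp.weight (R := ℕ) (w ∘ Fin.succ)) := by
  let e : (Fin k →₀ ℕ) ⊕ (Fin (k + 1) →₀ ℕ) → (Fin (k + 1) →₀ ℕ) :=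
    Sum.elim (Finsupp.cons 0) fun m => m + Finsupp.single 0 1
  have he : Function.Bijective e := by
    constructor
    · rintro (a | a) (b | b) h
      · have := congrArg Finsupp.tail h
        simpa [e] using this
      · have := DFunLike.congr_fun h 0
        simp [e] at this
      · have := DFunLike.congr_fun h 0
        simp [e] at this
      · simpa [e] using h
    · intro m
      by_cases h : m 0 = 0
      · refine ⟨Sum.inl (Finsupp.tail m), ?_⟩
        have := Finsupp.cons_tail m
        rwa [h] at this
      · refine ⟨Sum.inr (m - Finsupp.single 0 1), ?_⟩
        refine tsub_add_cancel_of_le ?_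
        simpa [Finsupp.single_le_iff] using Nat.one_le_iff_ne_zero.2 h
  have hc : Finsupp.weight w ∘ Equiv.ofBijective e he =
      Sum.elim (Finsupp.weight (w ∘ Fin.succ)) (fun m => Finsupp.weight w m + w 0) := by
    funext m
    rcases m with m | m
    · simp [e, weight_fin_succ]
    · simp [e, Finsupp.weight_single]
  have h1 := countSeries_comp_equiv (Equiv.ofBijective e he) (Finsupp.weight (R := ℕ) w)
  rw [hc, countSeries_sum, countSeries_add_const] at h1
  · linear_combination -h1
  · exact finite_weight_eq fun i => hw _
  · exact finite_add_const (finite_weight_eq hw) _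

theorem prod_mul_countSeries_weight {k : ℕ} {w : Fin k → σ →₀ ℕ} (hw : ∀ i, w i ≠ 0) :
    (∏ i, (1 - MvPowerSeries.monomial (w i) 1)) * countSeries (Finsupp.weight (R := ℕ) w) = 1 := by
  induction k with
  | zero =>
    classical
    ext n
    rw [Fintype.prod_empty, one_mul, coeff_countSeries, MvPowerSeries.coeff_one]
    have h0 : ∀ m : Fin 0 →₀ ℕ, Finsupp.weight w m = 0 := fun m => by
      rw [Subsingleton.elim m 0, map_zero]
    split_ifs with h
    · subst h
      have : Unique {m : Fin 0 →₀ ℕ // Finsupp.weight w m = 0} :=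
        ⟨⟨⟨0, h0 0⟩⟩, fun a => Subtype.ext (Subsingleton.elim _ _)⟩
      simp
    · have : IsEmpty {m : Fin 0 →₀ ℕ // Finsupp.weight w m = n} :=
        ⟨fun m => h (by rw [← m.2, h0])⟩
      simp
  | succ k ih =>
    rw [Fin.prod_univ_succ, mul_comm (1 - _), mul_assoc, one_sub_mul_countSeries_weight hw]
    exact ih fun i => hw _

end CountSeries

/-! ### Homogeneous parts of a span of homogeneous vectors. -/

section GradedSpan

variable {K V ι M : Type*} [Field K] [AddCommGroup V] [Module K V]

/-- Split an element into its contributions of degree `n` and of other degrees. If the sum has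
degree `n`, so does the second contribution, which independence then makes zero. -/
theorem span_range_inf_eq {b : ι → V} {deg : ι → M} {G : M → Submodule K V} (hG : iSupIndep G)
    (hb : ∀ i, b i ∈ G (deg i)) (n : M) :
    Submodule.span K (Set.range b) ⊓ G n = Submodule.span K (b '' {i | deg i = n}) := by
  apply le_antisymm
  · rintro f ⟨hf, hn⟩
    rw [← Set.image_univ, ← Set.union_compl_self {i | deg i = n}, Set.image_union,
      Submodule.span_union] at hf
    obtain ⟨f₁, h₁, f₂, h₂, rfl⟩ := Submodule.mem_sup.1 hf
    have h₁' : f₁ ∈ G n := by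
      refine Submodule.span_le.2 ?_ h₁
      rintro _ ⟨i, rfl, rfl⟩
      exact hb i
    have h₂' : f₂ ∈ ⨆ (m) (_ : m ≠ n), G m := by
      refine Submodule.span_le.2 ?_ h₂
      rintro _ ⟨i, hi, rfl⟩
      exact Submodule.mem_iSup_of_mem (deg i) (Submodule.mem_iSup_of_mem hi (hb i))
    have h₀ : f₂ = 0 :=
      Submodule.disjoint_def.1 (hG n) f₂ (by simpa using sub_mem hn h₁') h₂'
    rwa [h₀, add_zero]
  · refine Submodule.span_le.2 ?_
    rintro _ ⟨i, rfl, rfl⟩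
    exact ⟨Submodule.subset_span ⟨i, rfl⟩, hb i⟩

theorem finrank_span_image {b : ι → V} (hb : LinearIndependent K b) (S : Set ι) [Finite S] :
    Module.finrank K (Submodule.span K (b '' S)) = Nat.card S := by
  have := Fintype.ofFinite S
  rw [Set.image_eq_range, Nat.card_eq_fintype_card]
  exact finrank_span_eq_card (hb.comp _ Subtype.val_injective)

end GradedSpan

/-! ### The weight grading, the module action and Fox derivatives. -/

section WeightComponents

variable {K : Type*} [Field K] {d : ℕ} {σ : Type*} (w : Fin d → σ →₀ ℕ)

theorem x_mul_mem_weightComp (i : Fin d) {n : σ →₀ ℕ} {f : FAlg K d} (hf : f ∈ weightComp K w n) :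
    x K d i * f ∈ weightComp K w (w i + n) := by
  induction hf using Submodule.span_induction with
  | mem y hy =>
    obtain ⟨l, rfl, rfl⟩ := hy
    exact Submodule.subset_span ⟨i :: l, by simp, by simp⟩
  | zero => simp
  | add y z _ _ hy hz => rw [mul_add]; exact add_mem hy hz
  | smul r y _ hy => rw [mul_smul_comm]; exact Submodule.smul_mem _ _ hy

theorem mul_x_mem_weightComp (i : Fin d) {n : σ →₀ ℕ} {f : FAlg K d} (hf : f ∈ weightComp K w n) :
    f * x K d i ∈ weightComp K w (w i + n) := by
  induction hf using Submodule.span_induction with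
  | mem y hy =>
    obtain ⟨l, rfl, rfl⟩ := hy
    exact Submodule.subset_span ⟨l ++ [i], by simp [add_comm], by simp⟩
  | zero => simp
  | add y z _ _ hy hz => rw [add_mul]; exact add_mem hy hz
  | smul r y _ hy => rw [smul_mul_assoc]; exact Submodule.smul_mem _ _ hy

theorem monomial_smul_mem_weightComp (s : Fin d ⊕ Fin d →₀ ℕ) {n : σ →₀ ℕ} {f : commIdeal K d}
    (hf : (f : FAlg K d) ∈ weightComp K w n) :
    ((MvPolynomial.monomial s (1 : K) • f : commIdeal K d) : FAlg K d) ∈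
      weightComp K w (Finsupp.weight (Sum.elim w w) s + n) := by
  induction s using Finsupp.induction_linear generalizing n f with
  | zero => simpa using hf
  | add s t hs ht =>
    have e : MvPolynomial.monomial (s + t) (1 : K) =
        MvPolynomial.monomial s 1 * MvPolynomial.monomial t 1 := by simp
    rw [e, mul_smul, map_add, add_assoc]
    exact hs (ht hf)
  | single a k =>
    induction k generalizing n f with
    | zero => simpa using hf
    | succ k ih =>
      have e : MvPolynomial.monomial (Finsupp.single a (k + 1)) (1 : K) =
          MvPolynomial.monomial (Finsupp.single a k) 1 * MvPolynomial.X a := by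
        rw [MvPolynomial.X, MvPolynomial.monomial_mul, ← Finsupp.single_add, one_mul]
      rw [e, mul_smul, Finsupp.weight_single, add_smul, one_smul, add_assoc,
        ← Finsupp.weight_single]
      apply ih
      rcases a with i | i
      · rw [coe_u_smul]; exact x_mul_mem_weightComp w i hf
      · rw [coe_v_smul]
        exact sub_mem (mul_x_mem_weightComp w i hf) (x_mul_mem_weightComp w i hf)

theorem smul_mem_weightComp {p : UV K d} {m n : σ →₀ ℕ}
    (hp : p.IsWeightedHomogeneous (Sum.elim w w) m) {f : commIdeal K d}
    (hf : (f : FAlg K d) ∈ weightComp K w n) :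
    ((p • f : commIdeal K d) : FAlg K d) ∈ weightComp K w (m + n) := by
  rw [p.as_sum, Finset.sum_smul, Submodule.coe_sum]
  refine sum_mem fun s hs => ?_
  have e : MvPolynomial.monomial s (p.coeff s) = p.coeff s • MvPolynomial.monomial s (1 : K) := by
    simp [MvPolynomial.smul_monomial]
  rw [e, smul_assoc, ← hp (MvPolynomial.mem_support_iff.1 hs)]
  exact Submodule.smul_mem _ _ (monomial_smul_mem_weightComp w s hf)

/-- The `k`-th Fox derivative lowers the weight by `w k`; the factor `u_k` compensates for this and
avoids subtraction of weights. The entry `1 1` is carried along because it enters the recursion for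
`0 1`. -/
theorem foxHom_word_isWeightedHomogeneous (k : Fin d) (l : List (Fin d)) :
    (foxHom k (l.map (x K d)).prod 1 1).IsWeightedHomogeneous (Sum.elim w w) (l.map w).sum ∧
    (MvPolynomial.X (Sum.inl k) * foxHom k (l.map (x K d)).prod 0 1).IsWeightedHomogeneous
      (Sum.elim w w) (l.map w).sum := by
  have hu : ∀ i, (MvPolynomial.X (Sum.inl i) : UV K d).IsWeightedHomogeneous (Sum.elim w w) (w i) :=
    fun i => MvPolynomial.isWeightedHomogeneous_X _ _ (Sum.inl i)
  have hv : ∀ i, (MvPolynomial.X (Sum.inr i) : UV K d).IsWeightedHomogeneous (Sum.elim w w) (w i) :=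
    fun i => MvPolynomial.isWeightedHomogeneous_X _ _ (Sum.inr i)
  induction l with
  | nil =>
    simpa using ⟨MvPolynomial.isWeightedHomogeneous_one _ _,
      MvPolynomial.isWeightedHomogeneous_zero _ _ _⟩
  | cons i l ih =>
    simp only [List.map_cons, List.prod_cons, List.sum_cons, map_mul, foxHom_x, Matrix.mul_apply,
      Fin.sum_univ_two]
    constructor
    · simpa [foxGen] using ((hu i).add (hv i)).mul ih.1
    · have e : ∀ a b : UV K d, MvPolynomial.X (Sum.inl k) * (foxGen K k i 0 0 * a + foxGen K k i 0 1 * b) =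
          MvPolynomial.X (Sum.inl i) * (MvPolynomial.X (Sum.inl k) * a) +
            (if i = k then MvPolynomial.X (Sum.inl i) else 0) * b := by
        intro a b
        by_cases h : i = k
        · subst h; simp [foxGen]; ring
        · simp [foxGen, h]; ring
      rw [e]
      refine ((hu i).mul ih.2).add (MvPolynomial.IsWeightedHomogeneous.mul ?_ ih.1)
      split_ifs
      · exact hu i
      · exact MvPolynomial.isWeightedHomogeneous_zero _ _ _

theorem X_mul_fox_isWeightedHomogeneous (k : Fin d) {n : σ →₀ ℕ} {f : FAlg K d}
    (hf : f ∈ weightComp K w n) :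
    (MvPolynomial.X (Sum.inl k) * fox k f).IsWeightedHomogeneous (Sum.elim w w) n := by
  rw [← MvPolynomial.mem_weightedHomogeneousSubmodule]
  induction hf using Submodule.span_induction with
  | mem y hy =>
    obtain ⟨l, rfl, rfl⟩ := hy
    exact (foxHom_word_isWeightedHomogeneous w k l).2
  | zero => simp
  | add y z _ _ hy hz => rw [map_add, mul_add]; exact add_mem hy hz
  | smul r y _ hy => rw [map_smul, mul_smul_comm]; exact Submodule.smul_mem _ _ hy

/-- Independence is inherited from the polynomial ring: after multiplication by `u_k`, Fox
derivatives respect weights, and on `F_3'` they are jointly injective. -/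
theorem iSupIndep_weightComp (w : Fin 3 → σ →₀ ℕ) :
    iSupIndep fun n => commIdeal K 3 ⊓ weightComp K w n := by
  intro n
  rw [Submodule.disjoint_def]
  rintro f ⟨hf, hn⟩ hs
  have key : ∀ k, fox k f = 0 := by
    intro k
    have h1 := (X_mul_fox_isWeightedHomogeneous w k hn).weightedHomogeneousComponent_same
    let π : FAlg K 3 →ₗ[K] UV K 3 :=
      (MvPolynomial.weightedHomogeneousComponent (Sum.elim w w) n).comp
        ((LinearMap.mulLeft K (MvPolynomial.X (Sum.inl k))).comp (fox k))
    have h2 : (⨆ (m) (_ : m ≠ n), commIdeal K 3 ⊓ weightComp K w m) ≤ LinearMap.ker π := by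
      refine iSup₂_le fun m hm => ?_
      rintro g ⟨-, hg⟩
      exact (X_mul_fox_isWeightedHomogeneous w k hg).weightedHomogeneousComponent_ne n hm.symm
    have h3 : π f = 0 := h2 hs
    have h4 : MvPolynomial.X (Sum.inl k) * fox k f = 0 := h1.symm.trans h3
    exact (mul_eq_zero.1 h4).resolve_left (MvPolynomial.X_ne_zero _)
  exact congrArg Subtype.val (eq_zero_of_fox_eq_zero (f := ⟨f, hf⟩) (key 1) (key 2))

end WeightComponents

/-! ### A homogeneous basis of the module of constants and its Hilbert series. -/

section Hilbert

variable (K : Type*) [Field K]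

/-- The parametrization of the constants in `F_3'`; in the coefficient of `c₃` the variable `v₁`
does not occur. -/
def combMap : MvPolynomial (Fin 5) K × MvPolynomial (Fin 5) K × MvPolynomial (Fin 4) K →ₗ[K]
    FAlg K 3 :=
  let s (c : commIdeal K 3) : MvPolynomial (Fin 5) K →ₗ[K] FAlg K 3 :=
    (commIdeal K 3).subtype ∘ₗ
      (LinearMap.toSpanSingleton (UV K 3) (commIdeal K 3) c).restrictScalars K ∘ₗ
        (constHom K).toLinearMap
  (s (c₁ K)).coprod ((s (c₂ K)).coprod (s (c₃ K) ∘ₗ (MvPolynomial.rename Fin.succ).toLinearMap))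

theorem combMap_apply (p q : MvPolynomial (Fin 5) K) (r : MvPolynomial (Fin 4) K) :
    combMap K (p, q, r) = (constHom K p • c₁ K + constHom K q • c₂ K +
      constHom K (MvPolynomial.rename Fin.succ r) • c₃ K : commIdeal K 3) := by
  simp [combMap, add_assoc]

variable {K}

theorem exists_X_zero_mul_add_rename {n : ℕ} (p : MvPolynomial (Fin (n + 1)) K) :
    ∃ q r, p = MvPolynomial.X 0 * q + MvPolynomial.rename Fin.succ r := by
  induction p using MvPolynomial.induction_on with
  | C a => exact ⟨0, MvPolynomial.C a, by simp⟩
  | add p p' hp hp' =>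
    obtain ⟨q, r, rfl⟩ := hp
    obtain ⟨q', r', rfl⟩ := hp'
    exact ⟨q + q', r + r', by rw [map_add]; ring⟩
  | mul_X p i hp =>
    obtain ⟨q, r, rfl⟩ := hp
    refine Fin.cases ?_ (fun i => ?_) i
    · exact ⟨MvPolynomial.X 0 * q + MvPolynomial.rename Fin.succ r, 0, by rw [map_zero]; ring⟩
    · exact ⟨q * MvPolynomial.X i.succ, r * MvPolynomial.X i, by
        rw [map_mul, MvPolynomial.rename_X]; ring⟩

theorem killVar_zero_rename_succ {n : ℕ} (r : MvPolynomial (Fin n) K) :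
    killVar 0 (MvPolynomial.rename Fin.succ r) = MvPolynomial.rename Fin.succ r := by
  have h : (killVar 0).comp (MvPolynomial.rename Fin.succ) =
      (MvPolynomial.rename Fin.succ : MvPolynomial (Fin n) K →ₐ[K] _) := by
    refine MvPolynomial.algHom_ext fun i => ?_
    rw [AlgHom.comp_apply, MvPolynomial.rename_X, killVar_X_of_ne K (Fin.succ_ne_zero i)]
  exact DFunLike.congr_fun h r

theorem range_combMap [CharZero K] :
    LinearMap.range (combMap K) = commIdeal K 3 ⊓ LinearMap.ker (der (δ₁₀ K)) := by
  apply le_antisymm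
  · rintro _ ⟨⟨p, q, r⟩, rfl⟩
    rw [combMap_apply]
    exact ⟨Subtype.coe_prop _, der_comb (constHom_mem _) (constHom_mem _) (constHom_mem _)⟩
  · rintro f ⟨hf, hd⟩
    obtain ⟨p, q, r, h⟩ := exists_comb_of_der_eq_zero (f := ⟨f, hf⟩) hd
    obtain ⟨s, r, rfl⟩ := exists_X_zero_mul_add_rename r
    refine ⟨(p - s * (MvPolynomial.X 1 * MvPolynomial.X 4), q + s * MvPolynomial.X 2, r), ?_⟩
    rw [combMap_apply]
    refine (congrArg Subtype.val ?_).trans (congrArg Subtype.val h).symm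
    have k1 : constHom K (p - s * (MvPolynomial.X 1 * MvPolynomial.X 4)) =
        constHom K p - constHom K s * (u K 0 * v K 2) := by
      rw [map_sub, map_mul, map_mul, constHom_X, constHom_X]; rfl
    have k2 : constHom K (q + s * MvPolynomial.X 2) = constHom K q + constHom K s * detUV K := by
      rw [map_add, map_mul, constHom_X]; rfl
    have k3 : ∀ r, constHom K (MvPolynomial.X 0 * s + r) = constHom K s * v K 0 + constHom K r := by
      intro r
      rw [map_add, map_mul, constHom_X, mul_comm]; rfl
    rw [k1, k2, k3]
    generalize constHom K p = p
    generalize constHom K q = q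
    generalize constHom K s = s
    generalize constHom K _ = r
    have hr := congrArg (s • ·) (generators_relation K)
    simp only [smul_zero, smul_add, smul_sub, ← mul_smul] at hr
    rw [← sub_eq_zero, ← neg_eq_zero, ← hr]
    simp only [sub_smul, add_smul]
    abel

/-- A relation is `s` times the basic one, so the coefficient of `c₃` equals `s v₁`. Since that
coefficient is free of `v₁`, `s = 0`. -/
theorem ker_combMap [CharZero K] : LinearMap.ker (combMap K) = ⊥ := by
  rw [LinearMap.ker_eq_bot']
  rintro ⟨p, q, r⟩ h
  rw [combMap_apply] at h
  have hc := constHom_injective K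
  obtain ⟨s, hp, hq, hr⟩ := exists_polyConst_of_comb_eq_zero
    (p := ⟨constHom K p, constHom_mem p⟩) (q := ⟨constHom K q, constHom_mem q⟩)
    (r := ⟨constHom K (MvPolynomial.rename Fin.succ r), constHom_mem _⟩) (Subtype.ext h)
  obtain ⟨s, hs⟩ := exists_constHom_eq s.2
  rw [← hs] at hp hq hr
  have hr' : MvPolynomial.rename Fin.succ r = s * MvPolynomial.X 0 := by
    apply hc
    rw [map_mul, constHom_X]; exact hr
  have hr₀ : MvPolynomial.rename Fin.succ r = 0 := by
    rw [← killVar_zero_rename_succ, hr', map_mul, killVar_X_self, mul_zero]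
  have hs₀ : s = 0 := by
    rw [hr₀] at hr'
    exact (mul_eq_zero.1 hr'.symm).resolve_right (MvPolynomial.X_ne_zero _)
  rw [hs₀, map_zero, zero_mul] at hp hq
  refine Prod.ext (hc ?_) (Prod.ext (hc ?_) ?_)
  · exact hp.trans (map_zero _).symm
  · exact hq.trans (neg_zero.trans (map_zero _).symm)
  · exact MvPolynomial.rename_injective _ (Fin.succ_injective _) (hr₀.trans (map_zero _).symm)

/-- The monomial basis of the domain of `combMap`. -/
def combBasis : Module.Basis ((Fin 5 →₀ ℕ) ⊕ (Fin 5 →₀ ℕ) ⊕ (Fin 4 →₀ ℕ)) K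
    (MvPolynomial (Fin 5) K × MvPolynomial (Fin 5) K × MvPolynomial (Fin 4) K) :=
  (MvPolynomial.basisMonomials _ K).prod
    ((MvPolynomial.basisMonomials _ K).prod (MvPolynomial.basisMonomials _ K))

/-- The degrees of `v₁, u₁, u₁ v₂ - u₂ v₁, u₃, v₃`. -/
def constDegree : Fin 5 → Fin 3 →₀ ℕ :=
  ![bidegree 0, bidegree 0, bidegree 0 + bidegree 1, bidegree 2, bidegree 2]

/-- The degrees of the basis elements of the module of constants. -/
def combDegree : (Fin 5 →₀ ℕ) ⊕ (Fin 5 →₀ ℕ) ⊕ (Fin 4 →₀ ℕ) → Fin 3 →₀ ℕ :=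
  Sum.elim (fun m => Finsupp.weight constDegree m + (bidegree 0 + bidegree 1))
    (Sum.elim (fun m => Finsupp.weight constDegree m + (bidegree 0 + bidegree 2))
      fun m => Finsupp.weight (constDegree ∘ Fin.succ) m + (bidegree 0 + bidegree 1 + bidegree 2))

variable (K) in
theorem constGen_isWeightedHomogeneous (i : Fin 5) :
    (constGen K i).IsWeightedHomogeneous (Sum.elim bidegree bidegree) (constDegree i) := by
  have hu : ∀ i, (u K i).IsWeightedHomogeneous (Sum.elim bidegree bidegree) (bidegree i) :=
    fun i => MvPolynomial.isWeightedHomogeneous_X _ _ (Sum.inl i)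
  have hv : ∀ i, (v K i).IsWeightedHomogeneous (Sum.elim bidegree bidegree) (bidegree i) :=
    fun i => MvPolynomial.isWeightedHomogeneous_X _ _ (Sum.inr i)
  fin_cases i
  · exact hv 0
  · exact hu 0
  · refine ((hu 0).mul (hv 1)).sub ?_
    rw [add_comm]
    exact (hu 1).mul (hv 0)
  · exact hu 2
  · exact hv 2

theorem constHom_isWeightedHomogeneous {p : MvPolynomial (Fin 5) K} {n : Fin 3 →₀ ℕ}
    (hp : p.IsWeightedHomogeneous constDegree n) :
    (constHom K p).IsWeightedHomogeneous (Sum.elim bidegree bidegree) n := by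
  rw [constHom, MvPolynomial.aeval_def, MvPolynomial.eval₂_eq]
  refine MvPolynomial.IsWeightedHomogeneous.sum _ _ _ fun s hs => ?_
  rw [← hp (MvPolynomial.mem_support_iff.1 hs), Finsupp.weight_apply, ← zero_add (Finsupp.sum _ _)]
  exact (MvPolynomial.isWeightedHomogeneous_C _ _).mul
    (MvPolynomial.IsWeightedHomogeneous.prod _ _ _ fun i _ =>
      (constGen_isWeightedHomogeneous K i).pow _)

theorem bracket_mem_weightComp {d : ℕ} {σ : Type*} (w : Fin d → σ →₀ ℕ) (i j : Fin d) :
    ⁅x K d i, x K d j⁆ ∈ weightComp K w (w i + w j) := by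
  have h : ∀ i, x K d i ∈ weightComp K w (w i) := fun i =>
    Submodule.subset_span ⟨[i], by simp, by simp⟩
  exact sub_mem (x_mul_mem_weightComp w i (h j)) (mul_x_mem_weightComp w i (h j))

theorem combMap_combBasis_mem (i : (Fin 5 →₀ ℕ) ⊕ (Fin 5 →₀ ℕ) ⊕ (Fin 4 →₀ ℕ)) :
    combMap K (combBasis i) ∈ commIdeal K 3 ⊓ weightComp K bidegree (combDegree i) := by
  have hm : ∀ m : Fin 5 →₀ ℕ, (constHom K (MvPolynomial.monomial m 1)).IsWeightedHomogeneous
      (Sum.elim bidegree bidegree) (Finsupp.weight constDegree m) := fun m =>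
    constHom_isWeightedHomogeneous (MvPolynomial.isWeightedHomogeneous_monomial _ _ _ rfl)
  have hb := bracket_mem_weightComp (K := K) bidegree
  have h1 : (c₁ K : FAlg K 3) ∈ weightComp K bidegree (bidegree 0 + bidegree 1) := by
    rw [add_comm]; exact hb 1 0
  have h2 : (c₂ K : FAlg K 3) ∈ weightComp K bidegree (bidegree 0 + bidegree 2) := by
    rw [add_comm]; exact hb 2 0
  have h3 : (c₃ K : FAlg K 3) ∈ weightComp K bidegree (bidegree 0 + bidegree 1 + bidegree 2) := by
    refine sub_mem ?_ ?_
    · have := x_mul_mem_weightComp bidegree 0 (hb 2 1)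
      rwa [add_comm (bidegree 2), ← add_assoc] at this
    · have := x_mul_mem_weightComp bidegree 1 (hb 2 0)
      rwa [add_comm (bidegree 2), ← add_assoc, add_comm (bidegree 1)] at this
  rcases i with m | m | m
  · have e : combBasis (K := K) (Sum.inl m) = (MvPolynomial.monomial m 1, 0, 0) := by
      simp [combBasis, Module.Basis.prod_apply]
      rfl
    rw [e, combMap_apply]
    simp only [map_zero, zero_smul, add_zero]
    exact ⟨Subtype.coe_prop _, smul_mem_weightComp _ (hm m) h1⟩
  · have e : combBasis (K := K) (Sum.inr (Sum.inl m)) = (0, MvPolynomial.monomial m 1, 0) := by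
      simp [combBasis, Module.Basis.prod_apply]
    rw [e, combMap_apply]
    simp only [map_zero, zero_smul, add_zero, zero_add]
    exact ⟨Subtype.coe_prop _, smul_mem_weightComp _ (hm m) h2⟩
  · have e : combBasis (K := K) (Sum.inr (Sum.inr m)) = (0, 0, MvPolynomial.monomial m 1) := by
      simp [combBasis, Module.Basis.prod_apply]
    rw [e, combMap_apply]
    simp only [map_zero, zero_smul, add_zero, zero_add]
    refine ⟨Subtype.coe_prop _, smul_mem_weightComp _ ?_ h3⟩
    have hw : Finsupp.weight (constDegree ∘ Fin.succ) m =
        Finsupp.weight constDegree (m.mapDomain Fin.succ) := by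
      simp only [Finsupp.weight_apply]
      rw [Finsupp.sum_mapDomain_index (by simp) (by simp [add_smul])]
      rfl
    rw [MvPolynomial.rename_monomial, hw]
    exact hm _

/-- The images of the monomial basis are homogeneous and span all constants, so those of degree `n`
span the component. -/
theorem constComp_eq_span [CharZero K] (n : Fin 3 →₀ ℕ) : constComp (δ₁₀ K) bidegree n =
    Submodule.span K ((combMap K ∘ combBasis) '' {i | combDegree i = n}) := by
  rw [← span_range_inf_eq (b := combMap K ∘ combBasis) (iSupIndep_weightComp bidegree)
    combMap_combBasis_mem n, constComp, ← range_combMap]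
  have h : Submodule.span K (Set.range (combMap K ∘ combBasis)) =
      LinearMap.range (combMap K) := by
    rw [Set.range_comp, Submodule.span_image, Module.Basis.span_eq, LinearMap.range_eq_map]
  rw [h]
  apply le_antisymm
  · rintro f ⟨h1, h2⟩
    exact ⟨h1, (range_combMap (K := K) ▸ h1).1, h2⟩
  · rintro f ⟨h1, _, h2⟩
    exact ⟨h1, h2⟩

theorem bidegree_ne_zero (i : Fin 3) : bidegree i ≠ 0 := by
  intro h
  have := DFunLike.congr_fun h 2
  fin_cases i <;> simp [bidegree] at this

theorem constDegree_ne_zero (i : Fin 5) : constDegree i ≠ 0 := by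
  fin_cases i <;> simp [constDegree, bidegree_ne_zero]

theorem finite_weight_constDegree (n : Fin 3 →₀ ℕ) :
    Finite {m : Fin 5 →₀ ℕ // Finsupp.weight constDegree m = n} :=
  finite_weight_eq constDegree_ne_zero n

theorem finite_weight_constDegree_succ (n : Fin 3 →₀ ℕ) :
    Finite {m : Fin 4 →₀ ℕ // Finsupp.weight (constDegree ∘ Fin.succ) m = n} :=
  finite_weight_eq (w := constDegree ∘ Fin.succ) (fun i => constDegree_ne_zero i.succ) n

theorem finite_combDegree_eq (n : Fin 3 →₀ ℕ) : Finite {i // combDegree i = n} := by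
  exact finite_sumElim_eq (finite_add_const finite_weight_constDegree _)
    (finite_sumElim_eq (finite_add_const finite_weight_constDegree _)
      (finite_add_const finite_weight_constDegree_succ _)) n

theorem finiteDimensional_constComp [CharZero K] (n : Fin 3 →₀ ℕ) :
    FiniteDimensional K (constComp (δ₁₀ K) bidegree n) := by
  rw [constComp_eq_span]
  have : Finite {i | combDegree i = n} := finite_combDegree_eq n
  exact FiniteDimensional.span_of_finite K ((Set.toFinite _).image _)

theorem hilbertSeries_eq_countSeries [CharZero K] :
    hilbertSeries (δ₁₀ K) bidegree = countSeries combDegree := by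
  ext n
  change (Module.finrank K (constComp (δ₁₀ K) bidegree n) : ℤ) = _
  have : Finite {i | combDegree i = n} := finite_combDegree_eq n
  rw [constComp_eq_span, finrank_span_image (combBasis.linearIndependent.map' _ ker_combMap)]
  rfl

theorem hilbertSeries_mul [CharZero K] :
    let t₁ : MvPowerSeries (Fin 3) ℤ := MvPowerSeries.X 0
    let t₂ : MvPowerSeries (Fin 3) ℤ := MvPowerSeries.X 1
    let z : MvPowerSeries (Fin 3) ℤ := MvPowerSeries.X 2
    hilbertSeries (δ₁₀ K) bidegree * ((1 - z) ^ 2 * (1 - t₁ * z) ^ 2 * (1 - t₁ * t₂ * z ^ 2)) =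
      t₁ * z ^ 2 + t₁ * t₂ * z ^ 2 + t₁ * t₂ * z ^ 3 - t₁ ^ 2 * t₂ * z ^ 4 := by
  intro t₁ t₂ z
  have hadd : ∀ a b : Fin 3 →₀ ℕ, MvPowerSeries.monomial (a + b) (1 : ℤ) =
      MvPowerSeries.monomial a 1 * MvPowerSeries.monomial b 1 := by
    intro a b; rw [MvPowerSeries.monomial_mul_monomial, one_mul]
  have e0 : MvPowerSeries.monomial (bidegree 0) (1 : ℤ) = t₁ * z := hadd _ _
  have e1 : MvPowerSeries.monomial (bidegree 1) (1 : ℤ) = t₂ * z := hadd _ _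
  have e2 : MvPowerSeries.monomial (bidegree 2) (1 : ℤ) = z := rfl
  have hs := one_sub_mul_countSeries_weight constDegree_ne_zero
  have hp := prod_mul_countSeries_weight constDegree_ne_zero
  have hH : countSeries combDegree =
      t₁ * z * (t₂ * z) * countSeries (Finsupp.weight (R := ℕ) constDegree) +
      (t₁ * z * z * countSeries (Finsupp.weight (R := ℕ) constDegree) +
      t₁ * z * (t₂ * z) * z * countSeries (Finsupp.weight (R := ℕ) (constDegree ∘ Fin.succ))) := by
    rw [combDegree, countSeries_sum, countSeries_sum, countSeries_add_const, countSeries_add_const,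
      countSeries_add_const, hadd, hadd, hadd, hadd, e0, e1, e2]
    · exact finite_add_const finite_weight_constDegree _
    · exact finite_add_const finite_weight_constDegree_succ _
    · exact finite_add_const finite_weight_constDegree _
    · exact finite_sumElim_eq (finite_add_const finite_weight_constDegree _)
        (finite_add_const finite_weight_constDegree_succ _)
  -- Omitting `v₁` multiplies the count by `1 - t₁z`, so all three summands become multiples of the
  -- five-variable series; this factor produces the negative term of the numerator.
  rw [hilbertSeries_eq_countSeries, hH, ← hs]
  rw [Fin.prod_univ_five] at hp
  simp only [constDegree, Matrix.cons_val, hadd, e0, e1, e2] at hp ⊢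
  linear_combination (t₁ * z ^ 2 + t₁ * t₂ * z ^ 2 + t₁ * t₂ * z ^ 3 - t₁ ^ 2 * t₂ * z ^ 4) * hp

end Hilbert

end FreeMetabelian

end

theorem mainTheorem6 (K : Type*) [Field K] [CharZero K] :
    -- the three elements generate the module of constants
    FreeMetabelian.constModule (FreeMetabelian.δ₁₀ K) =
      Submodule.span (FreeMetabelian.polyConst (FreeMetabelian.δ₁₀ K))
        {FreeMetabelian.c₁ K, FreeMetabelian.c₂ K, FreeMetabelian.c₃ K} ∧
    -- the relation, in the module and written out in commutators
    (FreeMetabelian.u K 0 * FreeMetabelian.v K 2) • FreeMetabelian.c₁ K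
      - (FreeMetabelian.u K 0 * FreeMetabelian.v K 1 - FreeMetabelian.u K 1 * FreeMetabelian.v K 0) •
          FreeMetabelian.c₂ K
      + FreeMetabelian.v K 0 • FreeMetabelian.c₃ K = 0 ∧
    (let x₁ := FreeMetabelian.x K 3 0
     let x₂ := FreeMetabelian.x K 3 1
     let x₃ := FreeMetabelian.x K 3 2
     x₁ * ⁅⁅x₂, x₁⁆, x₃⁆ - (x₁ * ⁅⁅x₃, x₁⁆, x₂⁆ - x₂ * ⁅⁅x₃, x₁⁆, x₁⁆)
      + ⁅x₁ * ⁅x₃, x₂⁆ - x₂ * ⁅x₃, x₁⁆, x₁⁆ = 0) ∧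
    -- every relation is a multiple of this one
    (∀ p₁ p₂ p₃ : FreeMetabelian.polyConst (FreeMetabelian.δ₁₀ K),
      p₁ • FreeMetabelian.c₁ K + p₂ • FreeMetabelian.c₂ K + p₃ • FreeMetabelian.c₃ K = 0 →
      ∃ q : FreeMetabelian.polyConst (FreeMetabelian.δ₁₀ K),
        (p₁ : FreeMetabelian.UV K 3) = q * (FreeMetabelian.u K 0 * FreeMetabelian.v K 2) ∧
        (p₂ : FreeMetabelian.UV K 3) = - (q * (FreeMetabelian.u K 0 * FreeMetabelian.v K 1
          - FreeMetabelian.u K 1 * FreeMetabelian.v K 0)) ∧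
        (p₃ : FreeMetabelian.UV K 3) = q * FreeMetabelian.v K 0) ∧
    -- the Hilbert series of the module of constants
    (∀ n, FiniteDimensional K
      (FreeMetabelian.constComp (FreeMetabelian.δ₁₀ K) FreeMetabelian.bidegree n)) ∧
    (let t₁ : MvPowerSeries (Fin 3) ℤ := MvPowerSeries.X 0
     let t₂ : MvPowerSeries (Fin 3) ℤ := MvPowerSeries.X 1
     let z : MvPowerSeries (Fin 3) ℤ := MvPowerSeries.X 2
     FreeMetabelian.hilbertSeries (FreeMetabelian.δ₁₀ K) FreeMetabelian.bidegree *
        ((1 - z) ^ 2 * (1 - t₁ * z) ^ 2 * (1 - t₁ * t₂ * z ^ 2)) =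
      t₁ * z ^ 2 + t₁ * t₂ * z ^ 2 + t₁ * t₂ * z ^ 3 - t₁ ^ 2 * t₂ * z ^ 4) :=
  ⟨FreeMetabelian.constModule_eq_span, FreeMetabelian.generators_relation K,
    FreeMetabelian.generators_relation_brackets K,
    fun _ _ _ h => FreeMetabelian.exists_polyConst_of_comb_eq_zero h,
    FreeMetabelian.finiteDimensional_constComp, FreeMetabelian.hilbertSeries_mul⟩
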